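/- \textbf{Definitions.} A sup-lattice is a poset with arbitrary suprema; linear maps are the maps preserving all suprema; $\otimes$ is the tensor product of sup-lattices, with unit $2=\{0\le 1\}$. For a set $X$, $\ell X$ is its power set. Let $s\ell_0$ be the full subcategory of sup-lattices on the objects $\ell X$; the functor $\ell\colon Rel\to s\ell_0$ sending a relation $R\subset X\times X'$ to its direct image map $\ell X\to\ell X'$ is an isomorphism of categories $Rel=s\ell_0$, where $Rel$ is the category of sets and relations. A localic group $G$ is a group object in the dual of the category of locales; equivalently, a locale $G$ with locale morphisms $w\colon G\to G\otimes G$, $e\colon G\to 2$, $\iota\colon G\to G$ (preserving finite infima and arbitrary suprema) making it a commutative Hopf algebra in sup-lattices with multiplication $\wedge$ and unit $1$. $Cmd_0(G)$ is the category of $G$-comodules of the form $\ell X$: its objects are sets $X$ with a linear map $\rho\colon\ell X\to G\otimes\ell X$ such that $(G\otimes\rho)\rho=(w\otimes\ell X)\rho$ and $(e\otimes\ell X)\rho$ is the canonical isomorphism $\ell X\cong 2\otimes\ell X$; its morphisms $(X,\rho)\to(X',\rho')$ are the linear maps $f\colon\ell X\to\ell X'$ with $\rho' f=(G\otimes f)\rho$.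 Let $T\colon Cmd_0(G)\to s\ell_0$ be the forgetful functor. For a set $X$, $Aut(X)$ is the locale with generators $\langle x|y\rangle$ ($x,y\in X$) subject to $\bigvee_y\langle x|y\rangle=1=\bigvee_y\langle y|x\rangle$ for all $x$, and $\langle x|y\rangle\wedge\langle x|y'\rangle=0=\langle y|x\rangle\wedge\langle y'|x\rangle$ for all $x$ and all $y\ne y'$. It is a localic group with $w\langle x|y\rangle=\bigvee_z\langle x|z\rangle\otimes\langle z|y\rangle$, $e\langle x|y\rangle=\delta_{x=y}$, $\iota\langle x|y\rangle=\langle y|x\rangle$. An object of $\beta^G$ is a set $X$ with an action of $G$, that is, a morphism of localic groups from $G$ to $Aut(X)$, given by a locale morphism $\mu\colon Aut(X)\to G$ commuting with $w$, $e$, $\iota$. A morphism $X\to X'$ in $\beta^G$ is a function $f$ with $\mu\langle a|b\rangle\le\mu'\langle f(a)|f(b)\rangle$ for all $a,b\in X$. Let $F\colon\beta^G\to Ens$ be the forgetful functor. $Rel(\beta^G)$ has the same objects as $\beta^G$; its arrows $X\to X'$ are the subobjects of $X\times X'$ in $\beta^G$, and the composite of $R\hookrightarrow X\times X'$ and $S\hookrightarrow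 X'\times X''$ is the image of $R\times_{X'}S\to X\times X''$. The functor $Rel(F)\colon Rel(\beta^G)\to Rel$ sends a subobject $R\hookrightarrow X\times X'$ to the image of $F(R)\to F(X)\times F(X')$. \textbf{Theorem.} Let $G$ be a localic group. There is an isomorphism of categories $\Phi\colon Cmd_0(G)\to Rel(\beta^G)$ such that $\ell\circ Rel(F)\circ\Phi=T$. The identification between relations $R\subset X\times X'$ and linear maps $\ell X\to\ell X'$ lifts along it: for any comodules $S=(X,\rho)$, $S'=(X',\rho')$ in $Cmd_0(G)$ and any relation $R\subset X\times X'$, the linear map $\ell R\colon\ell X\to\ell X'$ is a comodule morphism $S\to S'$ if and only if $R$ is the underlying relation $Rel(F)(f)$ of an arrow $f\colon\Phi(S)\to\Phi(S')$ of $Rel(\beta^G)$. -/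

import Mathlib

set_option linter.unusedVariables false

universe u v w

/-! ### Sup-lattices and their tensor product

A sup-lattice is a complete lattice, a linear map is an `sSupHom`, the unit `2` is `Prop`,
and `ℓX` is `Set X`. -/

/-- A map of two variables which preserves suprema in each variable. -/
structure IsBilin {S T U : Type*} [CompleteLattice S] [CompleteLattice T] [CompleteLattice U]
    (f : S → T → U) : Prop where
  sSup_left : ∀ (A : Set S) (t : T), f (sSup A) t = ⨆ a ∈ A, f a t
  sSup_right : ∀ (s : S) (B : Set T), f s (sSup B) = ⨆ b ∈ B, f s b

/-- The tensor product of two sup-lattices: its elements are the sets of pairs that are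
closed, in each variable, under suprema and under passing to smaller elements. -/
@[ext]
structure SupTensor (S : Type u) (T : Type v) [CompleteLattice S] [CompleteLattice T] where
  carrier : Set (S × T)
  left_mem : ∀ (A : Set S) (t : T), (sSup A, t) ∈ carrier ↔ ∀ a ∈ A, (a, t) ∈ carrier
  right_mem : ∀ (s : S) (B : Set T), (s, sSup B) ∈ carrier ↔ ∀ b ∈ B, (s, b) ∈ carrier

namespace SupTensor

section Lattice

variable {S : Type u} {T : Type v} [CompleteLattice S] [CompleteLattice T]

instance : PartialOrder (SupTensor S T) where
  le D E := D.carrier ⊆ E.carrier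
  le_refl D := Set.Subset.refl _
  le_trans D E F h k := Set.Subset.trans h k
  le_antisymm D E h k := SupTensor.ext (Set.Subset.antisymm h k)

theorem le_def {D E : SupTensor S T} : D ≤ E ↔ ∀ p ∈ D.carrier, p ∈ E.carrier := Iff.rfl

instance : InfSet (SupTensor S T) where
  sInf 𝒟 :=
    { carrier := {p | ∀ D ∈ 𝒟, p ∈ D.carrier}
      left_mem := fun A t =>
        ⟨fun h a ha D hD => (D.left_mem A t).1 (h D hD) a ha,
          fun h D hD => (D.left_mem A t).2 fun a ha => h a ha D hD⟩
      right_mem := fun s B =>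
        ⟨fun h b hb D hD => (D.right_mem s B).1 (h D hD) b hb,
          fun h D hD => (D.right_mem s B).2 fun b hb => h b hb D hD⟩ }

instance : CompleteLattice (SupTensor S T) :=
  completeLatticeOfInf _ fun 𝒟 =>
    ⟨fun D hD _ hp => hp D hD, fun _ hE _ hp _ hD => hE hD hp⟩

theorem mem_sInf {𝒟 : Set (SupTensor S T)} {p : S × T} :
    p ∈ (sInf 𝒟).carrier ↔ ∀ D ∈ 𝒟, p ∈ D.carrier := Iff.rfl

theorem mem_inf {D E : SupTensor S T} {p : S × T} :
    p ∈ (D ⊓ E).carrier ↔ p ∈ D.carrier ∧ p ∈ E.carrier := by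
  rw [← sInf_pair, mem_sInf]
  simp

theorem mem_of_le_left (D : SupTensor S T) {a b : S} {t : T} (h : a ≤ b)
    (hb : (b, t) ∈ D.carrier) : (a, t) ∈ D.carrier := by
  have hs : sSup {a, b} = b := by rw [sSup_pair]; exact sup_eq_right.2 h
  exact (D.left_mem {a, b} t).1 (by rw [hs]; exact hb) a (by simp)

theorem mem_of_le_right (D : SupTensor S T) {s : S} {a b : T} (h : a ≤ b)
    (hb : (s, b) ∈ D.carrier) : (s, a) ∈ D.carrier := by
  have hs : sSup {a, b} = b := by rw [sSup_pair]; exact sup_eq_right.2 h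
  exact (D.right_mem s {a, b}).1 (by rw [hs]; exact hb) a (by simp)

theorem mem_of_le (D : SupTensor S T) {a b : S} {c d : T} (h : a ≤ b) (h' : c ≤ d)
    (hb : (b, d) ∈ D.carrier) : (a, c) ∈ D.carrier :=
  D.mem_of_le_left h (D.mem_of_le_right h' hb)

/-- The pure tensor `s ⊗ t`. -/
def tmul (s : S) (t : T) : SupTensor S T := sInf {D | (s, t) ∈ D.carrier}

theorem tmul_le_iff {s : S} {t : T} {D : SupTensor S T} :
    tmul s t ≤ D ↔ (s, t) ∈ D.carrier :=
  ⟨fun h => h fun _ hE => hE, fun h => sInf_le h⟩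

theorem le_iff_tmul {D E : SupTensor S T} :
    D ≤ E ↔ ∀ s t, tmul s t ≤ D → tmul s t ≤ E := by
  simp only [tmul_le_iff]
  exact ⟨fun h s t hD => h hD, fun h p hp => h p.1 p.2 hp⟩

theorem tmul_mono {a b : S} {c d : T} (h : a ≤ b) (h' : c ≤ d) : tmul a c ≤ tmul b d :=
  tmul_le_iff.2 (mem_of_le _ h h' (tmul_le_iff.1 le_rfl))

theorem isBilin_tmul : IsBilin (tmul : S → T → SupTensor S T) where
  sSup_left A t := eq_of_forall_ge_iff fun D => by
    simp only [tmul_le_iff, iSup_le_iff]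
    exact D.left_mem A t
  sSup_right s B := eq_of_forall_ge_iff fun D => by
    simp only [tmul_le_iff, iSup_le_iff]
    exact D.right_mem s B

theorem eq_iSup_tmul (D : SupTensor S T) : D = ⨆ p ∈ D.carrier, tmul p.1 p.2 :=
  eq_of_forall_ge_iff fun E => by
    simp only [iSup_le_iff, tmul_le_iff]
    exact Iff.rfl

end Lattice

section Lift

variable {S : Type u} {T : Type v} {U : Type w} [CompleteLattice S] [CompleteLattice T]
  [CompleteLattice U]

/-- The linear map out of the tensor product that corresponds to a bilinear map. -/
def lift (f : S → T → U) (hf : IsBilin f) : sSupHom (SupTensor S T) U where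
  toFun D := ⨆ p ∈ D.carrier, f p.1 p.2
  map_sSup' := by
    let r : U → SupTensor S T := fun x =>
      { carrier := {p | f p.1 p.2 ≤ x}
        left_mem := fun A t => by
          simp only [Set.mem_ofPred_eq, hf.sSup_left, iSup_le_iff]
        right_mem := fun s B => by
          simp only [Set.mem_ofPred_eq, hf.sSup_right, iSup_le_iff] }
    have gc : GaloisConnection (fun D : SupTensor S T => ⨆ p ∈ D.carrier, f p.1 p.2) r := by
      intro D x
      simp only [iSup_le_iff]
      exact Iff.rfl
    intro 𝒟
    rw [gc.l_sSup, sSup_image]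

theorem lift_apply (f : S → T → U) (hf : IsBilin f) (D : SupTensor S T) :
    lift f hf D = ⨆ p ∈ D.carrier, f p.1 p.2 := rfl

@[simp]
theorem lift_tmul (f : S → T → U) (hf : IsBilin f) (s : S) (t : T) :
    lift f hf (tmul s t) = f s t := by
  apply le_antisymm
  · let E : SupTensor S T :=
      { carrier := {p | f p.1 p.2 ≤ f s t}
        left_mem := fun A t => by
          simp only [Set.mem_ofPred_eq, hf.sSup_left, iSup_le_iff]
        right_mem := fun s B => by
          simp only [Set.mem_ofPred_eq, hf.sSup_right, iSup_le_iff] }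
    have hE : tmul s t ≤ E := tmul_le_iff.2 (le_refl (f s t))
    rw [lift_apply]
    exact iSup₂_le fun p hp => hE hp
  · rw [lift_apply]
    exact le_iSup₂_of_le (s, t) (tmul_le_iff.1 le_rfl) le_rfl

theorem hom_ext {f g : sSupHom (SupTensor S T) U}
    (h : ∀ s t, f (tmul s t) = g (tmul s t)) : f = g := by
  ext D
  rw [eq_iSup_tmul D]
  simp only [map_iSup, h]

end Lift

section Functoriality

variable {S : Type*} {T : Type*} {S' : Type*} {T' : Type*} {U : Type*}
  [CompleteLattice S] [CompleteLattice T] [CompleteLattice S'] [CompleteLattice T']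
  [CompleteLattice U]

theorem isBilin_map (f : sSupHom S S') (g : sSupHom T T') :
    IsBilin fun s t => tmul (f s) (g t) where
  sSup_left A t := by
    rw [map_sSup, isBilin_tmul.sSup_left, iSup_image]
  sSup_right s B := by
    rw [map_sSup, isBilin_tmul.sSup_right, iSup_image]

/-- The tensor product `f ⊗ g` of two linear maps. -/
def map (f : sSupHom S S') (g : sSupHom T T') : sSupHom (SupTensor S T) (SupTensor S' T') :=
  lift _ (isBilin_map f g)

@[simp]
theorem map_tmul (f : sSupHom S S') (g : sSupHom T T') (s : S) (t : T) :
    map f g (tmul s t) = tmul (f s) (g t) := lift_tmul _ _ _ _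

theorem isBilin_assocAux (c : U) :
    IsBilin fun (a : S) (b : T) => tmul a (tmul b c) where
  sSup_left A t := isBilin_tmul.sSup_left _ _
  sSup_right s B := by
    rw [isBilin_tmul.sSup_left, ← sSup_image, isBilin_tmul.sSup_right, iSup_image]

theorem isBilin_assoc :
    IsBilin fun (x : SupTensor S T) (c : U) =>
      lift (fun (a : S) (b : T) => tmul a (tmul b c)) (isBilin_assocAux c) x where
  sSup_left A c := by rw [map_sSup, sSup_image]
  sSup_right x B := by
    simp only [lift_apply]
    have h : ∀ (a : S) (b : T), tmul a (tmul b (sSup B)) = ⨆ c ∈ B, tmul a (tmul b c) := by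
      intro a b
      rw [isBilin_tmul.sSup_right, ← sSup_image, isBilin_tmul.sSup_right, iSup_image]
    simp only [h]
    apply le_antisymm
    · exact iSup₂_le fun p hp => iSup₂_le fun c hc =>
        le_iSup₂_of_le c hc (le_iSup₂_of_le p hp le_rfl)
    · exact iSup₂_le fun c hc => iSup₂_le fun p hp =>
        le_iSup₂_of_le p hp (le_iSup₂_of_le c hc le_rfl)

/-- The associativity `(S ⊗ T) ⊗ U → S ⊗ (T ⊗ U)`. -/
def assoc (S : Type*) (T : Type*) (U : Type*)
    [CompleteLattice S] [CompleteLattice T] [CompleteLattice U] :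
    sSupHom (SupTensor (SupTensor S T) U) (SupTensor S (SupTensor T U)) :=
  lift _ isBilin_assoc

@[simp]
theorem assoc_tmul (a : S) (b : T) (c : U) :
    assoc S T U (tmul (tmul a b) c) = tmul a (tmul b c) := by
  simp [assoc]

theorem isBilin_lid : IsBilin fun (p : Prop) (s : S) => ⨆ _ : p, s where
  sSup_left A s := by
    apply le_antisymm
    · refine iSup_le fun h => ?_
      obtain ⟨p, hp, hp'⟩ := h
      exact le_iSup₂_of_le p hp (le_iSup_of_le hp' le_rfl)
    · exact iSup₂_le fun p hp => iSup_le fun h => le_iSup_of_le ⟨p, hp, h⟩ le_rfl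
  sSup_right p B := by
    rw [sSup_eq_iSup]
    apply le_antisymm
    · exact iSup_le fun h => iSup₂_le fun b hb =>
        le_iSup₂_of_le b hb (le_iSup_of_le h le_rfl)
    · exact iSup₂_le fun b hb => iSup_le fun h =>
        le_iSup_of_le h (le_iSup₂_of_le b hb le_rfl)

theorem isBilin_rid : IsBilin fun (s : S) (p : Prop) => ⨆ _ : p, s where
  sSup_left A p := isBilin_lid.sSup_right p A
  sSup_right s A := isBilin_lid.sSup_left A s

/-- The unit isomorphism `2 ⊗ S → S`. -/
def lid (S : Type*) [CompleteLattice S] : sSupHom (SupTensor Prop S) S := lift _ isBilin_lid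

/-- The unit isomorphism `S ⊗ 2 → S`. -/
def rid (S : Type*) [CompleteLattice S] : sSupHom (SupTensor S Prop) S := lift _ isBilin_rid

@[simp]
theorem lid_tmul (p : Prop) (s : S) : lid S (tmul p s) = ⨆ _ : p, s := lift_tmul _ _ _ _

@[simp]
theorem rid_tmul (s : S) (p : Prop) : rid S (tmul s p) = ⨆ _ : p, s := lift_tmul _ _ _ _

end Functoriality

section Frame

variable {S : Type u} {T : Type v} [Order.Frame S] [Order.Frame T]

/-- The tensor product of two locales is a locale. -/
instance : Order.Frame (SupTensor S T) :=
  Order.Frame.ofMinimalAxioms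
    { inf_sSup_le_iSup_inf := by
        intro D 𝒟
        let E := ⨆ D' ∈ 𝒟, D ⊓ D'
        let I : SupTensor S T :=
          { carrier := {p | ∀ s t, s ≤ p.1 → t ≤ p.2 → (s, t) ∈ D.carrier → (s, t) ∈ E.carrier}
            left_mem := fun A t => by
              constructor
              · intro h a ha s' t' hs ht hD
                exact h s' t' (hs.trans (le_sSup ha)) ht hD
              · intro h s' t' hs ht hD
                have hs' : s' = sSup ((fun a => s' ⊓ a) '' A) := by
                  rw [sSup_image, ← inf_sSup_eq]
                  exact (inf_eq_left.2 hs).symm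
                rw [hs', E.left_mem]
                rintro _ ⟨a, ha, rfl⟩
                exact h a ha _ _ inf_le_right ht (D.mem_of_le_left inf_le_left hD)
            right_mem := fun s B => by
              constructor
              · intro h b hb s' t' hs ht hD
                exact h s' t' hs (ht.trans (le_sSup hb)) hD
              · intro h s' t' hs ht hD
                have ht' : t' = sSup ((fun b => t' ⊓ b) '' B) := by
                  rw [sSup_image, ← inf_sSup_eq]
                  exact (inf_eq_left.2 ht).symm
                rw [ht', E.right_mem]
                rintro _ ⟨b, hb, rfl⟩
                exact h b hb _ _ hs inf_le_right (D.mem_of_le_right inf_le_left hD) }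
        have hI : sSup 𝒟 ≤ I := by
          refine sSup_le fun D' hD' p hp s t hs ht hD => ?_
          have : D ⊓ D' ≤ E := le_iSup₂_of_le D' hD' le_rfl
          exact this (mem_inf.2 ⟨hD, D'.mem_of_le hs ht hp⟩)
        intro p hp
        obtain ⟨hp1, hp2⟩ := mem_inf.1 hp
        exact hI hp2 p.1 p.2 le_rfl le_rfl hp1 }

theorem isBilin_inf : IsBilin fun (a b : S) => a ⊓ b where
  sSup_left _ _ := sSup_inf_eq
  sSup_right _ _ := inf_sSup_eq

/-- The multiplication `G ⊗ G → G` of a locale, induced by `⊓`. -/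
def mul (S : Type u) [Order.Frame S] : sSupHom (SupTensor S S) S := lift _ isBilin_inf

@[simp]
theorem mul_tmul (a b : S) : mul S (tmul a b) = a ⊓ b := lift_tmul _ _ _ _

theorem top_tmul_top : tmul (⊤ : S) (⊤ : T) = ⊤ :=
  top_le_iff.1 (le_iff_tmul.2 fun _ _ _ => tmul_mono le_top le_top)

@[simp]
theorem bot_tmul (t : T) : tmul (⊥ : S) t = ⊥ := by
  rw [← sSup_empty, isBilin_tmul.sSup_left]; simp

@[simp]
theorem tmul_bot (s : S) : tmul s (⊥ : T) = ⊥ := by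
  rw [← sSup_empty, isBilin_tmul.sSup_right]; simp

theorem iSup_tmul {ι : Sort*} (f : ι → S) (t : T) : tmul (⨆ i, f i) t = ⨆ i, tmul (f i) t := by
  rw [iSup, isBilin_tmul.sSup_left, iSup_range]

theorem tmul_iSup {ι : Sort*} (s : S) (f : ι → T) : tmul s (⨆ i, f i) = ⨆ i, tmul s (f i) := by
  rw [iSup, isBilin_tmul.sSup_right, iSup_range]

/-- The elements of `s ⊗ t` are the pairs below `(s, t)`, and those with a zero component. -/
theorem mem_tmul {s a : S} {t b : T} :
    (a, b) ∈ (tmul s t).carrier ↔ (a ≤ s ∧ b ≤ t) ∨ a = ⊥ ∨ b = ⊥ := by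
  classical
  constructor
  · intro h
    let E : SupTensor S T :=
      { carrier := {p | (p.1 ≤ s ∧ p.2 ≤ t) ∨ p.1 = ⊥ ∨ p.2 = ⊥}
        left_mem := fun A c => by
          simp only [Set.mem_ofPred_eq, sSup_le_iff, sSup_eq_bot]
          by_cases hc : c = ⊥
          · simp [hc]
          by_cases hct : c ≤ t
          · simp only [hct, hc, and_true, or_false]
            constructor
            · rintro (h | h) a ha
              exacts [Or.inl (h a ha), Or.inr (h a ha)]
            · intro h
              exact Or.inl fun a ha => (h a ha).elim id fun h' => h' ▸ bot_le
          · simp [hc, hct]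
        right_mem := fun c A => by
          simp only [Set.mem_ofPred_eq, sSup_le_iff, sSup_eq_bot]
          by_cases hc : c = ⊥
          · simp [hc]
          by_cases hct : c ≤ s
          · simp only [hct, hc, true_and, false_or]
            constructor
            · rintro (h | h) a ha
              exacts [Or.inl (h a ha), Or.inr (h a ha)]
            · intro h
              exact Or.inl fun a ha => (h a ha).elim id fun h' => h' ▸ bot_le
          · simp [hc, hct] }
    have hE : tmul s t ≤ E := tmul_le_iff.2 (Or.inl ⟨le_rfl, le_rfl⟩)
    exact hE h
  · rintro (⟨h, h'⟩ | h | h)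
    · exact mem_of_le _ h h' (tmul_le_iff.1 le_rfl)
    · rw [← tmul_le_iff, h, bot_tmul]; exact bot_le
    · rw [← tmul_le_iff, h, tmul_bot]; exact bot_le

theorem tmul_inf_tmul (a c : S) (b d : T) :
    tmul a b ⊓ tmul c d = tmul (a ⊓ c) (b ⊓ d) := by
  apply le_antisymm
  · rintro ⟨x, y⟩ h
    obtain ⟨h1, h2⟩ := mem_inf.1 h
    rw [mem_tmul] at h1 h2 ⊢
    rcases h1 with h1 | h1
    · rcases h2 with h2 | h2
      · exact Or.inl ⟨le_inf h1.1 h2.1, le_inf h1.2 h2.2⟩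
      · exact Or.inr h2
    · exact Or.inr h1
  · exact le_inf (tmul_mono inf_le_left inf_le_left) (tmul_mono inf_le_right inf_le_right)

end Frame

end SupTensor

/-! ### Localic groups as Hopf algebras in sup-lattices -/

/-- The linear map underlying a morphism of locales. -/
def FrameHom.lin {S T : Type*} [CompleteLattice S] [CompleteLattice T] (f : FrameHom S T) :
    sSupHom S T := ⟨f, map_sSup f⟩

@[simp]
theorem FrameHom.lin_apply {S T : Type*} [CompleteLattice S] [CompleteLattice T]
    (f : FrameHom S T) (x : S) : f.lin x = f x := rfl

namespace SupTensor

variable {S T S' T' U : Type*} [Order.Frame S] [Order.Frame T] [Order.Frame S'] [Order.Frame T']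
  [Order.Frame U]

/-- A linear map out of a tensor product of locales that is multiplicative on pure tensors
is a morphism of locales. -/
def frameHomOf (f : sSupHom (SupTensor S T) U) (top : f (tmul ⊤ ⊤) = ⊤)
    (inf : ∀ a b c d, f (tmul (a ⊓ c) (b ⊓ d)) = f (tmul a b) ⊓ f (tmul c d)) :
    FrameHom (SupTensor S T) U where
  toFun := f
  map_sSup' := map_sSup f
  map_top' := by rw [← top_tmul_top]; exact top
  map_inf' x y := by
    rw [eq_iSup_tmul x, eq_iSup_tmul y]
    simp only [iSup_inf_eq, inf_iSup_eq, map_iSup, tmul_inf_tmul, inf]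

/-- The tensor product of two morphisms of locales, as a morphism of locales. -/
def mapFrame (f : FrameHom S S') (g : FrameHom T T') :
    FrameHom (SupTensor S T) (SupTensor S' T') :=
  frameHomOf (map f.lin g.lin) (by rw [map_tmul]; simp [top_tmul_top]) (by simp [tmul_inf_tmul])

@[simp]
theorem mapFrame_apply (f : FrameHom S S') (g : FrameHom T T') (x : SupTensor S T) :
    mapFrame f g x = map f.lin g.lin x := rfl

end SupTensor

open SupTensor in
/-- A localic group structure on (the space whose locale of opens is) `G`: the structure of a
commutative Hopf algebra in sup-lattices on the algebra `(G, ⊓, ⊤)`. -/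
class LocalicGroup (G : Type v) [Order.Frame G] where
  comul : FrameHom G (SupTensor G G)
  counit : FrameHom G Prop
  antipode : FrameHom G G
  coassoc : ∀ x, assoc G G G (map comul.lin (sSupHom.id G) (comul x)) =
    map (sSupHom.id G) comul.lin (comul x)
  counit_left : ∀ x, lid G (map counit.lin (sSupHom.id G) (comul x)) = x
  counit_right : ∀ x, rid G (map (sSupHom.id G) counit.lin (comul x)) = x
  antipode_left : ∀ x, mul G (map antipode.lin (sSupHom.id G) (comul x)) = ⨆ _ : counit x, ⊤
  antipode_right : ∀ x, mul G (map (sSupHom.id G) antipode.lin (comul x)) = ⨆ _ : counit x, ⊤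

/-- Morphisms of Hopf algebras `H → G` between localic groups, that is, morphisms of localic
groups in the opposite direction. -/
structure HopfHom (H : Type u) (G : Type v) [Order.Frame H] [Order.Frame G]
    [LocalicGroup H] [LocalicGroup G] where
  hom : FrameHom H G
  comul : ∀ x, LocalicGroup.comul (hom x) =
    SupTensor.map hom.lin hom.lin (LocalicGroup.comul x)
  counit : ∀ x, LocalicGroup.counit (hom x) = LocalicGroup.counit x
  antipode : ∀ x, LocalicGroup.antipode (hom x) = hom (LocalicGroup.antipode x)

/-! ### The localic group of automorphisms of a set -/

/-- An `ℓ`-bijection: a relation with values in a locale which is everywhere defined,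
univalued, surjective and injective. -/
structure IsLBijection {X Y : Type*} {G : Type*} [Order.Frame G] (r : X → Y → G) : Prop where
  ed : ∀ a, ⨆ y, r a y = ⊤
  uv : ∀ x b₁ b₂, b₁ ≠ b₂ → r x b₁ ⊓ r x b₂ = ⊥
  su : ∀ b, ⨆ x, r x b = ⊤
  inj : ∀ a₁ a₂ y, a₁ ≠ a₂ → r a₁ y ⊓ r a₂ y = ⊥

/-- The locale `Aut(X)` presented by generators `⟨a | b⟩` subject to the axioms of an
`ℓ`-bijection. A finite set of pairs stands for the meet of the corresponding generators;
the elements of the locale are the families of finite sets that are closed under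
enlargement (going down in the meet-semilattice) and under the covers forcing the axioms. -/
@[ext]
structure AutLocale (X : Type u) where
  carrier : Set (Finset (X × X))
  up : ∀ F F', F ⊆ F' → F ∈ carrier → F' ∈ carrier
  ed : ∀ F a, (∀ y F', F ⊆ F' → (a, y) ∈ F' → F' ∈ carrier) → F ∈ carrier
  uv : ∀ F x b₁ b₂, b₁ ≠ b₂ → (x, b₁) ∈ F → (x, b₂) ∈ F → F ∈ carrier
  su : ∀ F b, (∀ x F', F ⊆ F' → (x, b) ∈ F' → F' ∈ carrier) → F ∈ carrier
  inj : ∀ F a₁ a₂ y, a₁ ≠ a₂ → (a₁, y) ∈ F → (a₂, y) ∈ F → F ∈ carrier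

namespace AutLocale

variable {X : Type u}

instance : PartialOrder (AutLocale X) where
  le I J := I.carrier ⊆ J.carrier
  le_refl I := Set.Subset.refl _
  le_trans I J K h k := Set.Subset.trans h k
  le_antisymm I J h k := AutLocale.ext (Set.Subset.antisymm h k)

instance : InfSet (AutLocale X) where
  sInf 𝒥 :=
    { carrier := {F | ∀ I ∈ 𝒥, F ∈ I.carrier}
      up := fun F F' h hF I hI => I.up F F' h (hF I hI)
      ed := fun F a h I hI => I.ed F a fun y F' hF hy => h y F' hF hy I hI
      uv := fun F x b₁ b₂ hb h₁ h₂ I _ => I.uv F x b₁ b₂ hb h₁ h₂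
      su := fun F a h I hI => I.su F a fun y F' hF hy => h y F' hF hy I hI
      inj := fun F x b₁ b₂ hb h₁ h₂ I _ => I.inj F x b₁ b₂ hb h₁ h₂ }

instance : CompleteLattice (AutLocale X) :=
  completeLatticeOfInf _ fun _ =>
    ⟨fun D hD _ hp => hp D hD, fun _ hE _ hp _ hD => hE hD hp⟩

theorem mem_sInf {𝒥 : Set (AutLocale X)} {F : Finset (X × X)} :
    F ∈ (sInf 𝒥).carrier ↔ ∀ I ∈ 𝒥, F ∈ I.carrier := Iff.rfl

theorem mem_inf {I J : AutLocale X} {F : Finset (X × X)} :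
    F ∈ (I ⊓ J).carrier ↔ F ∈ I.carrier ∧ F ∈ J.carrier := by
  rw [← sInf_pair, mem_sInf]
  simp

/-- The largest element whose meet with `A` is below `J`. -/
def imp (A : Set (Finset (X × X))) (hA : ∀ F F', F ⊆ F' → F ∈ A → F' ∈ A) (J : AutLocale X) :
    AutLocale X where
  carrier := {F | ∀ F', F ⊆ F' → F' ∈ A → F' ∈ J.carrier}
  up F F' h hF F'' h' hA' := hF F'' (h.trans h') hA'
  ed F a h F' hF hA' := J.ed F' a fun y F'' hF'' hy =>
    h y F'' (hF.trans hF'') hy F'' subset_rfl (hA _ _ hF'' hA')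
  uv F x b₁ b₂ hb h₁ h₂ F' hF _ := J.uv F' x b₁ b₂ hb (hF h₁) (hF h₂)
  su F a h F' hF hA' := J.su F' a fun y F'' hF'' hy =>
    h y F'' (hF.trans hF'') hy F'' subset_rfl (hA _ _ hF'' hA')
  inj F x b₁ b₂ hb h₁ h₂ F' hF _ := J.inj F' x b₁ b₂ hb (hF h₁) (hF h₂)

instance : Order.Frame (AutLocale X) :=
  Order.Frame.ofMinimalAxioms
    { inf_sSup_le_iSup_inf := by
        intro I 𝒥
        let E := ⨆ J ∈ 𝒥, I ⊓ J
        have h : sSup 𝒥 ≤ imp I.carrier I.up E := by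
          refine sSup_le fun J hJ F hF F' hF' hI => ?_
          have : I ⊓ J ≤ E := le_iSup₂_of_le J hJ le_rfl
          exact this (mem_inf.2 ⟨hI, J.up _ _ hF' hF⟩)
        intro F hF
        obtain ⟨h1, h2⟩ := mem_inf.1 hF
        exact h h2 F subset_rfl h1 }

/-- The element generated by a finite set. -/
def principal (F : Finset (X × X)) : AutLocale X := sInf {I | F ∈ I.carrier}

theorem principal_le_iff {F : Finset (X × X)} {I : AutLocale X} :
    principal F ≤ I ↔ F ∈ I.carrier :=
  ⟨fun h => h fun _ hE => hE, fun h => sInf_le h⟩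

/-- The generator `⟨a | b⟩`. -/
def gen (a b : X) : AutLocale X := principal {(a, b)}

theorem principal_mono {F F' : Finset (X × X)} (h : F ⊆ F') : principal F' ≤ principal F :=
  principal_le_iff.2 ((principal F).up _ _ h (principal_le_iff.1 le_rfl))

theorem principal_eq (F : Finset (X × X)) : principal F = F.inf fun p => gen p.1 p.2 := by
  classical
  induction F using Finset.induction_on with
  | empty =>
    rw [Finset.inf_empty]
    refine top_le_iff.1 fun F _ => ?_
    exact (principal ∅).up ∅ F (Finset.empty_subset _) (principal_le_iff.1 le_rfl)
  | insert p F hp ih =>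
    rw [Finset.inf_insert, ← ih]
    apply le_antisymm
    · refine le_inf (principal_mono ?_) (principal_mono (Finset.subset_insert _ _))
      simp
    · have h : principal F ≤ imp {F' | p ∈ F'} (fun _ _ h h' => h h') (principal (insert p F)) :=
        principal_le_iff.2 fun F' hF hp => (principal (insert p F)).up (insert p F) F'
          (Finset.insert_subset hp hF) (principal_le_iff.1 le_rfl)
      have h' : gen p.1 p.2 ≤
          imp (principal F).carrier (principal F).up (principal (insert p F)) :=
        principal_le_iff.2 fun F' hp hF =>
          h hF F' subset_rfl (hp (Finset.mem_singleton_self _))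
      intro F' hF'
      obtain ⟨h1, h2⟩ := mem_inf.1 hF'
      exact h' h1 F' subset_rfl h2

theorem eq_iSup_principal (I : AutLocale X) : I = ⨆ F ∈ I.carrier, principal F :=
  eq_of_forall_ge_iff fun E => by
    simp only [iSup_le_iff, principal_le_iff]
    exact Iff.rfl

theorem isLBijection_gen : IsLBijection (gen : X → X → AutLocale X) where
  ed a := top_le_iff.1 fun F _ => AutLocale.ed _ F a fun y F' _ hy =>
    (show principal F' ≤ ⨆ y, gen a y from
      (principal_mono (by simpa using hy)).trans (le_iSup (gen a) y)) (principal_le_iff.1 le_rfl)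
  uv x b₁ b₂ hb := by
    classical
    have h : gen x b₁ ⊓ gen x b₂ = principal {(x, b₁), (x, b₂)} := by simp [principal_eq]
    rw [h]
    exact le_bot_iff.1 (principal_le_iff.2 (AutLocale.uv _ _ x b₁ b₂ hb (by simp) (by simp)))
  su b := top_le_iff.1 fun F _ => AutLocale.su _ F b fun x F' _ hy =>
    (show principal F' ≤ ⨆ x, gen x b from
      (principal_mono (by simpa using hy)).trans (le_iSup (fun x => gen x b) x))
      (principal_le_iff.1 le_rfl)
  inj a₁ a₂ y hb := by
    classical
    have h : gen a₁ y ⊓ gen a₂ y = principal {(a₁, y), (a₂, y)} := by simp [principal_eq]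
    rw [h]
    exact le_bot_iff.1 (principal_le_iff.2 (AutLocale.inj _ _ a₁ a₂ y hb (by simp) (by simp)))

/-- Two morphisms of locales out of `Aut(X)` are equal if they agree on generators. -/
theorem hom_ext {H : Type*} [Order.Frame H] {f g : FrameHom (AutLocale X) H}
    (h : ∀ a b, f (gen a b) = g (gen a b)) : f = g := by
  ext I
  rw [eq_iSup_principal I]
  simp only [map_iSup, principal_eq, map_finset_inf, Function.comp_def, h]

section Lift

variable {H : Type*} [Order.Frame H] (r : X → X → H) (hr : IsLBijection r)

theorem inf_insert_inf [DecidableEq (X × X)] (F : Finset (X × X)) (p : X × X) :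
    (insert p F).inf (fun p => r p.1 p.2) = F.inf (fun p => r p.1 p.2) ⊓ r p.1 p.2 := by
  rw [Finset.inf_insert, inf_comm]

/-- The right adjoint of the morphism of locales that corresponds to an `ℓ`-bijection. -/
def liftAdj (x : H) : AutLocale X where
  carrier := {F | F.inf (fun p => r p.1 p.2) ≤ x}
  up F F' h hF := (Finset.inf_mono h).trans hF
  ed F a h := by
    classical
    have : F.inf (fun p => r p.1 p.2) = ⨆ y, F.inf (fun p => r p.1 p.2) ⊓ r a y := by
      rw [← inf_iSup_eq, hr.ed, inf_top_eq]
    rw [Set.mem_ofPred_eq, this]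
    refine iSup_le fun y => ?_
    rw [← inf_insert_inf r F (a, y)]
    exact h y _ (Finset.subset_insert _ _) (Finset.mem_insert_self _ _)
  uv F x b₁ b₂ hb h₁ h₂ :=
    (le_inf (Finset.inf_le h₁) (Finset.inf_le h₂)).trans
      ((hr.uv x b₁ b₂ hb).le.trans bot_le)
  su F a h := by
    classical
    have : F.inf (fun p => r p.1 p.2) = ⨆ y, F.inf (fun p => r p.1 p.2) ⊓ r y a := by
      rw [← inf_iSup_eq, hr.su, inf_top_eq]
    rw [Set.mem_ofPred_eq, this]
    refine iSup_le fun y => ?_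
    rw [← inf_insert_inf r F (y, a)]
    exact h y _ (Finset.subset_insert _ _) (Finset.mem_insert_self _ _)
  inj F a₁ a₂ y hb h₁ h₂ :=
    (le_inf (Finset.inf_le h₁) (Finset.inf_le h₂)).trans
      ((hr.inj a₁ a₂ y hb).le.trans bot_le)

/-- The universal property of `Aut(X)`: an `ℓ`-bijection on `X` with values in a locale
extends to a morphism of locales. -/
def lift : FrameHom (AutLocale X) H where
  toFun I := ⨆ F ∈ I.carrier, F.inf fun p => r p.1 p.2
  map_sSup' 𝒥 := by
    have gc : GaloisConnection
        (fun I : AutLocale X => ⨆ F ∈ I.carrier, F.inf fun p => r p.1 p.2) (liftAdj r hr) := by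
      intro I x
      simp only [iSup_le_iff]
      exact Iff.rfl
    rw [gc.l_sSup, sSup_image]
  map_top' := top_le_iff.1 (le_iSup₂_of_le (f := fun (F : Finset (X × X))
    (_ : F ∈ (⊤ : AutLocale X).carrier) => F.inf fun p => r p.1 p.2) ∅
    (principal_le_iff.1 le_top) (by simp))
  map_inf' I J := by
    classical
    apply le_antisymm
    · refine iSup₂_le fun F hF => ?_
      obtain ⟨h1, h2⟩ := mem_inf.1 hF
      exact le_inf (le_iSup₂_of_le F h1 le_rfl) (le_iSup₂_of_le F h2 le_rfl)
    · simp only [iSup_inf_eq, inf_iSup_eq]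
      refine iSup₂_le fun F hF => iSup₂_le fun F' hF' => ?_
      rw [← Finset.inf_union]
      exact le_iSup₂_of_le (F' ∪ F) (mem_inf.2
        ⟨I.up _ _ Finset.subset_union_left hF', J.up _ _ Finset.subset_union_right hF⟩) le_rfl

@[simp]
theorem lift_gen (a b : X) : lift r hr (gen a b) = r a b := by
  apply le_antisymm
  · have h : gen a b ≤ liftAdj r hr (r a b) := principal_le_iff.2 (by
      change Finset.inf _ _ ≤ _
      simp)
    exact iSup₂_le fun F hF => h hF
  · exact le_iSup₂_of_le {(a, b)} (principal_le_iff.1 le_rfl) (by simp)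

end Lift

end AutLocale

theorem IsLBijection.map {X Y : Type*} {G H : Type*} [Order.Frame G] [Order.Frame H]
    {r : X → Y → G} (hr : IsLBijection r) (f : FrameHom G H) :
    IsLBijection fun x y => f (r x y) where
  ed a := by rw [← map_iSup, hr.ed, map_top]
  uv x b₁ b₂ hb := by rw [← map_inf, hr.uv x b₁ b₂ hb, map_bot]
  su b := by rw [← map_iSup, hr.su, map_top]
  inj a₁ a₂ y ha := by rw [← map_inf, hr.inj a₁ a₂ y ha, map_bot]

namespace SupTensor

variable {S T U : Type*} [Order.Frame S] [Order.Frame T] [Order.Frame U]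

/-- The associativity, as a morphism of locales. -/
def assocFrame (S T U : Type*) [Order.Frame S] [Order.Frame T] [Order.Frame U] :
    FrameHom (SupTensor (SupTensor S T) U) (SupTensor S (SupTensor T U)) :=
  frameHomOf (assoc S T U) (by rw [← top_tmul_top, assoc_tmul, top_tmul_top, top_tmul_top])
    (by
      intro a b c d
      rw [eq_iSup_tmul a, eq_iSup_tmul c]
      simp only [iSup_inf_eq, inf_iSup_eq, map_iSup, tmul_inf_tmul, iSup_tmul, assoc_tmul])

/-- The unit isomorphism `2 ⊗ S → S`, as a morphism of locales. -/
def lidFrame (S : Type*) [Order.Frame S] : FrameHom (SupTensor Prop S) S :=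
  frameHomOf (lid S) (by simp) (by
    intro a b c d
    simp only [lid_tmul, iSup_inf_eq, inf_iSup_eq, inf_Prop_eq, iSup_and]
    exact iSup_comm)

/-- The unit isomorphism `S ⊗ 2 → S`, as a morphism of locales. -/
def ridFrame (S : Type*) [Order.Frame S] : FrameHom (SupTensor S Prop) S :=
  frameHomOf (rid S) (by simp) (by
    intro a b c d
    simp only [rid_tmul, iSup_inf_eq, inf_iSup_eq, inf_Prop_eq, iSup_and]
    exact iSup_comm)

/-- The multiplication, as a morphism of locales. -/
def mulFrame (S : Type*) [Order.Frame S] : FrameHom (SupTensor S S) S :=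
  frameHomOf (mul S) (by simp) (by
    intro a b c d
    simp only [mul_tmul]
    exact inf_inf_inf_comm _ _ _ _)

end SupTensor

/-- The unique morphism of locales out of `2`. -/
def FrameHom.ofProp (S : Type*) [Order.Frame S] : FrameHom Prop S where
  toFun p := ⨆ _ : p, ⊤
  map_top' := by simp
  map_inf' p q := by simp only [inf_Prop_eq, iSup_and, iSup_inf_eq, top_inf_eq]
  map_sSup' A := by
    rw [sSup_image]
    exact SupTensor.isBilin_lid.sSup_left A ⊤

namespace AutLocale

open SupTensor

variable (X : Type u)

theorem isLBijection_comul :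
    IsLBijection fun a b : X => ⨆ z, tmul (gen a z) (gen z b) where
  ed a := by
    rw [iSup_comm]
    simp only [← tmul_iSup, isLBijection_gen.ed, ← iSup_tmul, top_tmul_top]
  su a := by
    rw [iSup_comm]
    simp only [← iSup_tmul, isLBijection_gen.su, ← tmul_iSup, top_tmul_top]
  uv x b₁ b₂ hb := by
    simp only [iSup_inf_eq, inf_iSup_eq, tmul_inf_tmul, iSup_eq_bot]
    intro z z'
    by_cases h : z = z'
    · rw [h, isLBijection_gen.uv _ _ _ hb, tmul_bot]
    · rw [isLBijection_gen.uv _ _ _ (Ne.symm h), bot_tmul]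
  inj a₁ a₂ y ha := by
    simp only [iSup_inf_eq, inf_iSup_eq, tmul_inf_tmul, iSup_eq_bot]
    intro z z'
    by_cases h : z = z'
    · rw [h, isLBijection_gen.inj _ _ _ ha, bot_tmul]
    · rw [isLBijection_gen.inj _ _ _ (Ne.symm h), tmul_bot]

theorem isLBijection_counit : IsLBijection fun a b : X => (a = b : Prop) where
  ed a := by simp
  su a := by simp
  uv x b₁ b₂ hb := by
    simp only [inf_Prop_eq, Prop.bot_eq_false, eq_iff_iff, iff_false]
    rintro ⟨rfl, rfl⟩
    exact hb rfl
  inj a₁ a₂ y ha := by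
    simp only [inf_Prop_eq, Prop.bot_eq_false, eq_iff_iff, iff_false]
    rintro ⟨rfl, rfl⟩
    exact ha rfl

theorem isLBijection_antipode : IsLBijection fun a b : X => gen b a where
  ed a := isLBijection_gen.su a
  su a := isLBijection_gen.ed a
  uv x b₁ b₂ hb := isLBijection_gen.inj _ _ _ hb
  inj a₁ a₂ y ha := isLBijection_gen.uv _ _ _ ha

/-- The comultiplication `⟨a | b⟩ ↦ ⋁ z, ⟨a | z⟩ ⊗ ⟨z | b⟩`. -/
def comulHom : FrameHom (AutLocale X) (SupTensor (AutLocale X) (AutLocale X)) :=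
  lift _ (isLBijection_comul X)

/-- The counit `⟨a | b⟩ ↦ (a = b)`. -/
def counitHom : FrameHom (AutLocale X) Prop := lift _ (isLBijection_counit X)

/-- The antipode `⟨a | b⟩ ↦ ⟨b | a⟩`. -/
def antipodeHom : FrameHom (AutLocale X) (AutLocale X) := lift _ (isLBijection_antipode X)

/-- The localic group `Aut(X)`. -/
instance : LocalicGroup (AutLocale X) where
  comul := comulHom X
  counit := counitHom X
  antipode := antipodeHom X
  coassoc := DFunLike.congr_fun (show
    ((assocFrame _ _ _).comp (mapFrame (comulHom X) (FrameHom.id _))).comp (comulHom X) =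
      (mapFrame (FrameHom.id _) (comulHom X)).comp (comulHom X) from hom_ext fun a b => by
      simp only [FrameHom.comp_apply, comulHom, lift_gen, map_iSup, mapFrame_apply, map_tmul,
        FrameHom.lin_apply, FrameHom.id_apply, iSup_tmul, tmul_iSup]
      rw [iSup_comm]
      refine iSup_congr fun z => iSup_congr fun z' => ?_
      exact assoc_tmul _ _ _)
  counit_left := DFunLike.congr_fun (show
    ((lidFrame _).comp (mapFrame (counitHom X) (FrameHom.id _))).comp (comulHom X) =
      FrameHom.id _ from hom_ext fun a b => by
      simp only [FrameHom.comp_apply, comulHom, counitHom, lift_gen, map_iSup, mapFrame_apply,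
        map_tmul, FrameHom.lin_apply, FrameHom.id_apply]
      refine (iSup_congr fun z => lid_tmul _ _).trans ?_
      simp)
  counit_right := DFunLike.congr_fun (show
    ((ridFrame _).comp (mapFrame (FrameHom.id _) (counitHom X))).comp (comulHom X) =
      FrameHom.id _ from hom_ext fun a b => by
      simp only [FrameHom.comp_apply, comulHom, counitHom, lift_gen, map_iSup, mapFrame_apply,
        map_tmul, FrameHom.lin_apply, FrameHom.id_apply]
      refine (iSup_congr fun z => rid_tmul _ _).trans ?_
      simp)
  antipode_left := DFunLike.congr_fun (show
    ((mulFrame _).comp (mapFrame (antipodeHom X) (FrameHom.id _))).comp (comulHom X) =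
      (FrameHom.ofProp _).comp (counitHom X) from hom_ext fun a b => by
      simp only [FrameHom.comp_apply, comulHom, counitHom, antipodeHom, lift_gen, map_iSup,
        mapFrame_apply, map_tmul, FrameHom.lin_apply, FrameHom.id_apply]
      refine (iSup_congr fun z => mul_tmul _ _).trans ?_
      change _ = ⨆ _ : a = b, ⊤
      by_cases h : a = b
      · subst h
        simp [isLBijection_gen.su]
      · simp [h, isLBijection_gen.uv _ _ _ h])
  antipode_right := DFunLike.congr_fun (show
    ((mulFrame _).comp (mapFrame (FrameHom.id _) (antipodeHom X))).comp (comulHom X) =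
      (FrameHom.ofProp _).comp (counitHom X) from hom_ext fun a b => by
      simp only [FrameHom.comp_apply, comulHom, counitHom, antipodeHom, lift_gen, map_iSup,
        mapFrame_apply, map_tmul, FrameHom.lin_apply, FrameHom.id_apply]
      refine (iSup_congr fun z => mul_tmul _ _).trans ?_
      change _ = ⨆ _ : a = b, ⊤
      by_cases h : a = b
      · subst h
        simp [isLBijection_gen.ed]
      · simp [h, isLBijection_gen.inj _ _ _ h])

variable {X}

@[simp]
theorem comul_gen (a b : X) :
    LocalicGroup.comul (gen a b) = ⨆ z, tmul (gen a z) (gen z b) :=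
  lift_gen _ (isLBijection_comul X) a b

@[simp]
theorem counit_gen (a b : X) : LocalicGroup.counit (gen a b) = (a = b) :=
  lift_gen _ (isLBijection_counit X) a b

@[simp]
theorem antipode_gen (a b : X) : LocalicGroup.antipode (gen a b) = gen b a :=
  lift_gen _ (isLBijection_antipode X) a b

end AutLocale

/-! ### The category `β^G` of sets with an action of a localic group -/

open CategoryTheory CategoryTheory.Limits

/-- A set furnished with an action of the localic group `G`: a morphism of localic groups from
`G` to `Aut(X)`, given by the corresponding Hopf algebra morphism `Aut(X) → G`. -/
structure GSet (G : Type v) [Order.Frame G] [LocalicGroup G] where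
  carrier : Type u
  act : HopfHom (AutLocale carrier) G

namespace GSet

variable {G : Type v} [Order.Frame G] [LocalicGroup G]

/-- The `ℓ`-relation `μ⟨a | b⟩` of an action. -/
def rel (X : GSet.{u, v} G) (a b : X.carrier) : G := X.act.hom (AutLocale.gen a b)

theorem isLBijection_rel (X : GSet.{u, v} G) : IsLBijection X.rel :=
  AutLocale.isLBijection_gen.map X.act.hom

theorem comul_rel (X : GSet.{u, v} G) (a b : X.carrier) :
    LocalicGroup.comul (X.rel a b) = ⨆ z, SupTensor.tmul (X.rel a z) (X.rel z b) := by
  simp [rel, X.act.comul, AutLocale.comul_gen, map_iSup]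

theorem counit_rel (X : GSet.{u, v} G) (a b : X.carrier) :
    LocalicGroup.counit (X.rel a b) = (a = b) := by
  simp [rel, X.act.counit]

theorem antipode_rel (X : GSet.{u, v} G) (a b : X.carrier) :
    LocalicGroup.antipode (X.rel a b) = X.rel b a := by
  simp [rel, X.act.antipode]

/-- An `ℓ`-bijection compatible with the Hopf algebra structures on generators is an action. -/
def ofRel (X : Type u) (r : X → X → G) (hr : IsLBijection r)
    (comul : ∀ a b, LocalicGroup.comul (r a b) = ⨆ z, SupTensor.tmul (r a z) (r z b))
    (counit : ∀ a b, LocalicGroup.counit (r a b) = (a = b))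
    (antipode : ∀ a b, LocalicGroup.antipode (r a b) = r b a) : GSet.{u, v} G where
  carrier := X
  act :=
    { hom := AutLocale.lift r hr
      comul := DFunLike.congr_fun (show
        LocalicGroup.comul.comp (AutLocale.lift r hr) =
          (SupTensor.mapFrame (AutLocale.lift r hr) (AutLocale.lift r hr)).comp
            LocalicGroup.comul from AutLocale.hom_ext fun a b => by
          simp [comul, map_iSup])
      counit := DFunLike.congr_fun (show
        LocalicGroup.counit.comp (AutLocale.lift r hr) = LocalicGroup.counit from
          AutLocale.hom_ext fun a b => by simp [counit])
      antipode := DFunLike.congr_fun (show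
        LocalicGroup.antipode.comp (AutLocale.lift r hr) =
          (AutLocale.lift r hr).comp LocalicGroup.antipode from
          AutLocale.hom_ext fun a b => by simp [antipode]) }

@[simp]
theorem rel_ofRel (X : Type u) (r : X → X → G) (hr : IsLBijection r) (h₁ h₂ h₃) (a b : X) :
    (ofRel X r hr h₁ h₂ h₃).rel a b = r a b := AutLocale.lift_gen r hr a b

/-- A morphism of `G`-sets: a function `f` with `μ⟨a | b⟩ ≤ μ'⟨f a | f b⟩`. -/
@[ext]
structure Hom (X Y : GSet.{u, v} G) where
  toFun : X.carrier → Y.carrier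
  rel_le : ∀ a b, X.rel a b ≤ Y.rel (toFun a) (toFun b)

instance : Category (GSet.{u, v} G) where
  Hom := Hom
  id X := ⟨id, fun _ _ => le_rfl⟩
  comp f g := ⟨g.toFun ∘ f.toFun, fun a b => (f.rel_le a b).trans (g.rel_le _ _)⟩

theorem id_toFun (X : GSet.{u, v} G) (a : X.carrier) : Hom.toFun (𝟙 X) a = a := rfl

theorem comp_toFun {X Y Z : GSet.{u, v} G} (f : X ⟶ Y) (g : Y ⟶ Z) (a : X.carrier) :
    Hom.toFun (f ≫ g) a = Hom.toFun g (Hom.toFun f a) := rfl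

theorem hom_ext {X Y : GSet.{u, v} G} {f g : X ⟶ Y} (h : ∀ a, Hom.toFun f a = Hom.toFun g a) :
    f = g := Hom.ext (funext h)

theorem toFun_congr {X Y : GSet.{u, v} G} {f g : X ⟶ Y} (h : f = g) (a : X.carrier) :
    Hom.toFun f a = Hom.toFun g a := by rw [h]

/-- The forgetful functor `F : β^G ⥤ Ens`. -/
def forgetful (G : Type v) [Order.Frame G] [LocalicGroup G] : GSet.{u, v} G ⥤ Type u where
  obj X := X.carrier
  map f := ↾(Hom.toFun f)

/-! Finite limits and images in `β^G` are those of the underlying sets. -/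

/-- The product of two `G`-sets. -/
def prodObj (X Y : GSet.{u, v} G) : GSet.{u, v} G :=
  ofRel (X.carrier × Y.carrier) (fun p q => X.rel p.1 q.1 ⊓ Y.rel p.2 q.2)
    { ed := fun a => by
        rw [iSup_prod]
        simp only [← inf_iSup_eq, X.isLBijection_rel.ed, Y.isLBijection_rel.ed,
          inf_top_eq]
      su := fun a => by
        rw [iSup_prod]
        simp only [← inf_iSup_eq, X.isLBijection_rel.su, Y.isLBijection_rel.su,
          inf_top_eq]
      uv := fun x b₁ b₂ hb => by
        rw [inf_inf_inf_comm]
        by_cases h : b₁.1 = b₂.1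
        · rw [Y.isLBijection_rel.uv _ _ _ fun h' => hb (Prod.ext h h'), inf_bot_eq]
        · rw [X.isLBijection_rel.uv _ _ _ h, bot_inf_eq]
      inj := fun a₁ a₂ y hb => by
        rw [inf_inf_inf_comm]
        by_cases h : a₁.1 = a₂.1
        · rw [Y.isLBijection_rel.inj _ _ _ fun h' => hb (Prod.ext h h'), inf_bot_eq]
        · rw [X.isLBijection_rel.inj _ _ _ h, bot_inf_eq] }
    (fun a b => by
      rw [map_inf, comul_rel, comul_rel, iSup_prod]
      simp only [iSup_inf_eq, inf_iSup_eq, SupTensor.tmul_inf_tmul]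
      exact iSup_comm)
    (fun a b => by 
      rw [map_inf, counit_rel, counit_rel]
      exact propext Prod.ext_iff.symm)
    (fun a b => by rw [map_inf, antipode_rel, antipode_rel])

@[simp]
theorem rel_prodObj (X Y : GSet.{u, v} G) (p q : X.carrier × Y.carrier) :
    (prodObj X Y).rel p q = X.rel p.1 q.1 ⊓ Y.rel p.2 q.2 := by
  simp only [prodObj, rel_ofRel]

/-- The first projection. -/
def prodFst (X Y : GSet.{u, v} G) : prodObj X Y ⟶ X :=
  ⟨Prod.fst, fun a b => (rel_prodObj X Y a b).le.trans inf_le_left⟩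

/-- The second projection. -/
def prodSnd (X Y : GSet.{u, v} G) : prodObj X Y ⟶ Y :=
  ⟨Prod.snd, fun a b => (rel_prodObj X Y a b).le.trans inf_le_right⟩

/-- The pairing of two morphisms of `G`-sets. -/
def prodPair {W X Y : GSet.{u, v} G} (f : W ⟶ X) (g : W ⟶ Y) : W ⟶ prodObj X Y :=
  ⟨fun w => (Hom.toFun f w, Hom.toFun g w), fun a b =>
    (le_inf (f.rel_le a b) (g.rel_le a b)).trans (rel_prodObj X Y (Hom.toFun f a, Hom.toFun g a) (Hom.toFun f b, Hom.toFun g b)).ge⟩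

/-- The action restricted to a subset that no pair of positive truth value leaves. -/
def sub (X : GSet.{u, v} G) (Z : Set X.carrier) (hZ : ∀ a ∈ Z, ∀ b ∉ Z, X.rel a b = ⊥) :
    GSet.{u, v} G :=
  have hZ' : ∀ a ∈ Z, ∀ b ∉ Z, X.rel b a = ⊥ := fun a ha b hb => by
    rw [← antipode_rel, hZ a ha b hb, map_bot]
  ofRel Z (fun a b => X.rel a b)
    { ed := fun a => top_le_iff.1 (by
        rw [← X.isLBijection_rel.ed a]
        refine iSup_le fun y => ?_
        by_cases hy : y ∈ Z
        · exact le_iSup (fun y : Z => X.rel a y) ⟨y, hy⟩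
        · rw [hZ a a.2 y hy]; exact bot_le)
      su := fun a => top_le_iff.1 (by
        rw [← X.isLBijection_rel.su a]
        refine iSup_le fun y => ?_
        by_cases hy : y ∈ Z
        · exact le_iSup (fun y : Z => X.rel y a) ⟨y, hy⟩
        · rw [hZ' a a.2 y hy]; exact bot_le)
      uv := fun x b₁ b₂ hb => X.isLBijection_rel.uv _ _ _ fun h => hb (Subtype.ext h)
      inj := fun a₁ a₂ y ha => X.isLBijection_rel.inj _ _ _ fun h => ha (Subtype.ext h) }
    (fun a b => by
      rw [comul_rel]
      apply le_antisymm
      · refine iSup_le fun z => ?_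
        by_cases hz : z ∈ Z
        · exact le_iSup (fun z : Z => SupTensor.tmul (X.rel a z) (X.rel z b)) ⟨z, hz⟩
        · rw [hZ a a.2 z hz, SupTensor.bot_tmul]; exact bot_le
      · exact iSup_le fun z =>
          le_iSup (fun z => SupTensor.tmul (X.rel a z) (X.rel z b)) (z : X.carrier))
    (fun a b => by rw [counit_rel, Subtype.ext_iff])
    (fun a b => antipode_rel X _ _)

section Sub

variable (X : GSet.{u, v} G) (Z : Set X.carrier) (hZ : ∀ a ∈ Z, ∀ b ∉ Z, X.rel a b = ⊥)

@[simp]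
theorem rel_sub (a b : Z) : (sub X Z hZ).rel a b = X.rel a b := by
  simp only [sub, rel_ofRel]

/-- The inclusion of a sub-`G`-set. -/
def subIncl : sub X Z hZ ⟶ X := ⟨Subtype.val, fun a b => (rel_sub X Z hZ a b).le⟩

instance : Mono (subIncl X Z hZ) where
  right_cancellation f g h := hom_ext fun a => Subtype.ext (toFun_congr h a)

/-- Morphisms with values in a sub-`G`-set. -/
def subLift {W : GSet.{u, v} G} (f : W ⟶ X) (hf : ∀ w, Hom.toFun f w ∈ Z) : W ⟶ sub X Z hZ :=
  ⟨fun w => ⟨Hom.toFun f w, hf w⟩, fun a b => (f.rel_le a b).trans (rel_sub X Z hZ ⟨Hom.toFun f a, hf a⟩ ⟨Hom.toFun f b, hf b⟩).ge⟩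

end Sub

theorem rel_inf_eq_bot {X Y : GSet.{u, v} G} (f : X ⟶ Y) (a b : X.carrier) (y : Y.carrier)
    (h : Hom.toFun f b ≠ y) : X.rel a b ⊓ Y.rel (Hom.toFun f a) y = ⊥ :=
  le_bot_iff.1 ((inf_le_inf_right _ (f.rel_le a b)).trans
    (Y.isLBijection_rel.uv _ _ _ h).le)

theorem rel_range {X Y : GSet.{u, v} G} (f : X ⟶ Y) :
    ∀ a ∈ Set.range (Hom.toFun f), ∀ b ∉ Set.range (Hom.toFun f), Y.rel a b = ⊥ := by
  rintro _ ⟨a, rfl⟩ b hb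
  rw [← top_inf_eq (Y.rel _ b), ← X.isLBijection_rel.ed a, iSup_inf_eq]
  exact iSup_eq_bot.2 fun x => rel_inf_eq_bot f a x b fun h => hb ⟨x, h⟩

theorem rel_eqLocus {X Y : GSet.{u, v} G} (f g : X ⟶ Y) :
    ∀ a ∈ {a | Hom.toFun f a = Hom.toFun g a}, ∀ b ∉ {a | Hom.toFun f a = Hom.toFun g a},
      X.rel a b = ⊥ := by
  intro a ha b hb
  rw [Set.mem_ofPred_eq] at ha hb
  refine le_bot_iff.1 ((le_inf (f.rel_le a b) (g.rel_le a b)).trans ?_)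
  rw [ha]
  exact (Y.isLBijection_rel.uv _ _ _ hb).le

/-- The pullback of two morphisms of `G`-sets. -/
def pullbackObj {X Y Z : GSet.{u, v} G} (f : X ⟶ Z) (g : Y ⟶ Z) : GSet.{u, v} G :=
  sub (prodObj X Y) _ (rel_eqLocus (prodFst X Y ≫ f) (prodSnd X Y ≫ g))

instance : HasBinaryProducts (GSet.{u, v} G) :=
  have (X Y : GSet.{u, v} G) : HasLimit (pair X Y) :=
    ⟨⟨⟨BinaryFan.mk (prodFst X Y) (prodSnd X Y),
      BinaryFan.IsLimit.mk _ (fun f g => prodPair f g) (fun _ _ => rfl) (fun _ _ => rfl)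
        (fun f g m h₁ h₂ => hom_ext fun a => Prod.ext (toFun_congr h₁ a) (toFun_congr h₂ a))⟩⟩⟩
  hasBinaryProducts_of_hasLimit_pair _

theorem pullback_condition {X Y Z : GSet.{u, v} G} (f : X ⟶ Z) (g : Y ⟶ Z) :
    (subIncl _ _ _ ≫ prodFst X Y : pullbackObj f g ⟶ X) ≫ f =
      (subIncl _ _ _ ≫ prodSnd X Y : pullbackObj f g ⟶ Y) ≫ g :=
  hom_ext fun a => a.2

instance : HasPullbacks (GSet.{u, v} G) :=
  have (X Y Z : GSet.{u, v} G) (f : X ⟶ Z) (g : Y ⟶ Z) : HasLimit (cospan f g) :=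
    ⟨⟨⟨PullbackCone.mk (W := pullbackObj f g) (subIncl _ _ _ ≫ prodFst X Y)
        (subIncl _ _ _ ≫ prodSnd X Y) (pullback_condition f g),
      PullbackCone.IsLimit.mk _
        (fun s => subLift _ _ _ (prodPair s.fst s.snd) fun w => toFun_congr s.condition w)
        (fun _ => rfl) (fun _ => rfl)
        (fun s m h₁ h₂ => hom_ext fun a =>
          Subtype.ext (Prod.ext (toFun_congr h₁ a) (toFun_congr h₂ a)))⟩⟩⟩
  hasPullbacks_of_hasLimit_cospan _

/-- The monomorphisms of `G`-sets are the injective morphisms. -/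
theorem mono_injective {X Y : GSet.{u, v} G} (f : X ⟶ Y) [Mono f] :
    Function.Injective (Hom.toFun f) := fun a b hab =>
  toFun_congr ((cancel_mono f).1 (pullback_condition f f)) ⟨(a, b), hab⟩

theorem rel_eq_of_mono {X Y : GSet.{u, v} G} (f : X ⟶ Y) [Mono f] (a b : X.carrier) :
    Y.rel (Hom.toFun f a) (Hom.toFun f b) = X.rel a b := by
  refine le_antisymm ?_ (f.rel_le a b)
  rw [← top_inf_eq (Y.rel _ _), ← X.isLBijection_rel.ed a, iSup_inf_eq]
  refine iSup_le fun x => ?_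
  by_cases h : x = b
  · rw [h]; exact inf_le_left
  · rw [rel_inf_eq_bot f a x _ fun h' => h (mono_injective f h')]; exact bot_le

/-- A morphism whose range is contained in that of a monomorphism factors through it. -/
theorem exists_factor {X Y Z : GSet.{u, v} G} (f : X ⟶ Y) (g : Z ⟶ Y) [Mono g]
    (h : ∀ x, ∃ z, Hom.toFun g z = Hom.toFun f x) : ∃ k : X ⟶ Z, k ≫ g = f := by
  choose k hk using h
  exact ⟨⟨k, fun a b => by rw [← rel_eq_of_mono g, hk, hk]; exact f.rel_le a b⟩, hom_ext hk⟩

/-- The factorisation of a morphism of `G`-sets through its range. -/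
def rangeFactorisation {X Y : GSet.{u, v} G} (f : X ⟶ Y) : MonoFactorisation f where
  I := sub Y _ (rel_range f)
  m := subIncl Y _ (rel_range f)
  e := subLift Y _ (rel_range f) f fun w => ⟨w, rfl⟩
  fac := rfl

instance : HasImages (GSet.{u, v} G) where
  has_image {X Y} f := by
    have h (F' : MonoFactorisation f) :
        ∃ k : (rangeFactorisation f).I ⟶ F'.I, k ≫ F'.m = (rangeFactorisation f).m :=
      exists_factor _ _ (by
        rintro ⟨_, a, rfl⟩
        exact ⟨Hom.toFun F'.e a, toFun_congr F'.fac a⟩)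
    choose k hk using h
    exact HasImage.mk ⟨rangeFactorisation f, ⟨k, hk⟩⟩

end GSet

/-! ### Relations in a category -/

section InternalRelations

variable {C : Type*} [Category C] [HasBinaryProducts C]

/-- The identity relation: the diagonal subobject. -/
noncomputable def relId (X : C) : Subobject (X ⨯ X) := Subobject.mk (diag X)

/-- The composite of two relations `R ↪ X × Y` and `S ↪ Y × Z`: the image of
`R ×_Y S → X × Z`. -/
noncomputable def relComp [HasPullbacks C] [HasImages C] {X Y Z : C}
    (R : Subobject (X ⨯ Y)) (S : Subobject (Y ⨯ Z)) : Subobject (X ⨯ Z) :=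
  imageSubobject (prod.lift
    (pullback.fst (R.arrow ≫ prod.snd) (S.arrow ≫ prod.fst) ≫ R.arrow ≫ prod.fst)
    (pullback.snd (R.arrow ≫ prod.snd) (S.arrow ≫ prod.fst) ≫ S.arrow ≫ prod.snd))

/-- The action on relations of a functor to sets: `R ↪ X × Y` goes to the image of
`F R → F X × F Y`. -/
def relMap (F : C ⥤ Type w) {X Y : C} (R : Subobject (X ⨯ Y)) : SetRel (F.obj X) (F.obj Y) :=
  Set.range fun r : F.obj (R : C) =>
    (F.map (R.arrow ≫ prod.fst) r, F.map (R.arrow ≫ prod.snd) r)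

end InternalRelations

namespace GSet

variable {G : Type v} [Order.Frame G] [LocalicGroup G]

theorem prod_ext {X Y : GSet.{u, v} G} {p q : (X ⨯ Y : GSet.{u, v} G).carrier}
    (h₁ : Hom.toFun (prod.fst : X ⨯ Y ⟶ X) p = Hom.toFun (prod.fst : X ⨯ Y ⟶ X) q)
    (h₂ : Hom.toFun (prod.snd : X ⨯ Y ⟶ Y) p = Hom.toFun (prod.snd : X ⨯ Y ⟶ Y) q) : p = q := by
  have h : prodPair (prod.fst : X ⨯ Y ⟶ X) prod.snd ≫ prod.lift (prodFst X Y) (prodSnd X Y) =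
      𝟙 (X ⨯ Y) := by
    apply Limits.prod.hom_ext
    · rw [Category.assoc, prod.lift_fst, Category.id_comp]; rfl
    · rw [Category.assoc, prod.lift_snd, Category.id_comp]; rfl
  have hp : Hom.toFun (prodPair (prod.fst : X ⨯ Y ⟶ X) prod.snd) p =
      Hom.toFun (prodPair (prod.fst : X ⨯ Y ⟶ X) prod.snd) q := Prod.ext h₁ h₂
  rw [← id_toFun _ p, ← id_toFun _ q, ← h, comp_toFun, comp_toFun, hp]

theorem mem_relMap {X Y : GSet.{u, v} G} {R : Subobject (X ⨯ Y)} {x : X.carrier}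
    {y : Y.carrier} :
    (x, y) ∈ relMap (forgetful G) R ↔ ∃ r : (R : GSet.{u, v} G).carrier,
      Hom.toFun (R.arrow ≫ prod.fst) r = x ∧ Hom.toFun (R.arrow ≫ prod.snd) r = y :=
  ⟨fun ⟨r, hr⟩ => ⟨r, congrArg Prod.fst hr, congrArg Prod.snd hr⟩,
    fun ⟨r, h₁, h₂⟩ => ⟨r, Prod.ext h₁ h₂⟩⟩

theorem le_of_relMap_subset {X Y : GSet.{u, v} G} {R S : Subobject (X ⨯ Y)}
    (h : relMap (forgetful G) R ⊆ relMap (forgetful G) S) : R ≤ S := by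
  obtain ⟨k, hk⟩ := exists_factor R.arrow S.arrow fun r => by
    obtain ⟨s, h₁, h₂⟩ := mem_relMap.1 (h (mem_relMap.2 ⟨r, rfl, rfl⟩))
    exact ⟨s, prod_ext h₁ h₂⟩
  exact Subobject.le_of_comm k hk

theorem relMap_injective {X Y : GSet.{u, v} G} :
    Function.Injective (relMap (forgetful G) : Subobject (X ⨯ Y) → _) := fun _ _ h =>
  le_antisymm (le_of_relMap_subset h.subset) (le_of_relMap_subset h.symm.subset)

/-- The underlying relation of the subobject represented by a monomorphism, or of an image. -/
theorem mem_relMap_image {W X Y : GSet.{u, v} G} {f : W ⟶ X ⨯ Y} {x : X.carrier}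
    {y : Y.carrier} :
    (x, y) ∈ relMap (forgetful G) (imageSubobject f) ↔ ∃ w : W.carrier,
      Hom.toFun (f ≫ prod.fst) w = x ∧ Hom.toFun (f ≫ prod.snd) w = y := by
  rw [mem_relMap]
  constructor
  · rintro ⟨r, rfl, rfl⟩
    have h : imageSubobject f ≤ Subobject.mk (rangeFactorisation f).m :=
      imageSubobject_le_mk _ _ (rangeFactorisation f).e (rangeFactorisation f).fac
    have hr := toFun_congr (Subobject.ofLEMk_comp h) r
    obtain ⟨w, hw⟩ := (Hom.toFun (Subobject.ofLEMk _ _ h) r).2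
    have hw' : Hom.toFun f w = Hom.toFun (imageSubobject f).arrow r := hw.trans hr
    exact ⟨w, by rw [comp_toFun, comp_toFun, hw'], by rw [comp_toFun, comp_toFun, hw']⟩
  · rintro ⟨w, rfl, rfl⟩
    have hw := toFun_congr (imageSubobject_arrow_comp f) w
    refine ⟨Hom.toFun (factorThruImageSubobject f) w, ?_, ?_⟩
    · rw [comp_toFun, comp_toFun, ← hw, comp_toFun]
    · rw [comp_toFun, comp_toFun, ← hw, comp_toFun]

theorem relMap_relId (X : GSet.{u, v} G) :
    relMap (forgetful G) (relId X) = (SetRel.id : SetRel X.carrier X.carrier) := by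
  refine Set.ext fun ⟨x, y⟩ => ?_
  rw [relId, ← imageSubobject_mono]
  refine mem_relMap_image.trans ?_
  simp only [prod.lift_fst, prod.lift_snd, id_toFun]
  exact ⟨fun ⟨w, h₁, h₂⟩ => h₁.symm.trans h₂, fun h => ⟨x, rfl, h⟩⟩

theorem relMap_relComp {X Y Z : GSet.{u, v} G} (R : Subobject (X ⨯ Y)) (S : Subobject (Y ⨯ Z)) :
    relMap (forgetful G) (relComp R S) =
      SetRel.comp (relMap (forgetful G) R) (relMap (forgetful G) S) := by
  refine Set.ext fun ⟨x, z⟩ => ?_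
  rw [relComp]
  refine mem_relMap_image.trans ?_
  simp only [prod.lift_fst, prod.lift_snd]
  constructor
  · rintro ⟨w, rfl, rfl⟩
    refine ⟨_, mem_relMap.2
        ⟨Hom.toFun (pullback.fst (R.arrow ≫ prod.snd) (S.arrow ≫ prod.fst)) w, rfl, rfl⟩,
      mem_relMap.2
        ⟨Hom.toFun (pullback.snd (R.arrow ≫ prod.snd) (S.arrow ≫ prod.fst)) w, ?_, rfl⟩⟩
    exact (toFun_congr pullback.condition w).symm
  · rintro ⟨y, h, h'⟩
    obtain ⟨r, rfl, hr⟩ := mem_relMap.1 h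
    obtain ⟨s, hs, rfl⟩ := mem_relMap.1 h'
    have hk := pullback_condition (R.arrow ≫ prod.snd) (S.arrow ≫ prod.fst)
    have h₁ := toFun_congr (pullback.lift_fst _ _ hk) ⟨(r, s), hr.trans hs.symm⟩
    have h₂ := toFun_congr (pullback.lift_snd _ _ hk) ⟨(r, s), hr.trans hs.symm⟩
    refine ⟨Hom.toFun (pullback.lift _ _ hk) ⟨(r, s), hr.trans hs.symm⟩, ?_, ?_⟩
    · exact congrArg (Hom.toFun (R.arrow ≫ prod.fst)) h₁
    · exact congrArg (Hom.toFun (S.arrow ≫ prod.snd)) h₂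

end GSet

/-- The category `Rel(β^G)` of relations in `β^G`: its objects are those of `β^G`. -/
structure RelGSet (G : Type v) [Order.Frame G] [LocalicGroup G] where
  obj : GSet.{u, v} G

namespace RelGSet

variable {G : Type v} [Order.Frame G] [LocalicGroup G]

/-- The arrows of `Rel(β^G)` are the subobjects of the product in `β^G`. -/
noncomputable instance : Category (RelGSet.{u, v} G) where
  Hom X Y := Subobject (X.obj ⨯ Y.obj)
  id X := relId X.obj
  comp R S := relComp R S
  id_comp R := GSet.relMap_injective (by
    rw [GSet.relMap_relComp, GSet.relMap_relId]
    exact SetRel.id_comp _)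
  comp_id R := GSet.relMap_injective (by
    rw [GSet.relMap_relComp, GSet.relMap_relId]
    exact SetRel.comp_id _)
  assoc R S T := GSet.relMap_injective (by
    simp only [GSet.relMap_relComp, SetRel.comp_assoc])

/-- The functor `Rel(F) : Rel(β^G) ⥤ Rel`. -/
def relForget (G : Type v) [Order.Frame G] [LocalicGroup G] :
    RelGSet.{u, v} G ⥤ RelCat.{u} where
  obj X := X.obj.carrier
  map {X Y} R := .ofRel (relMap (GSet.forgetful G) (X := X.obj) (Y := Y.obj) R)
  map_id X := RelCat.Hom.ext _ _ (GSet.relMap_relId X.obj)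
  map_comp {X Y Z} R S := RelCat.Hom.ext _ _
    (GSet.relMap_relComp (X := X.obj) (Y := Y.obj) (Z := Z.obj) R S)

end RelGSet

/-! ### The category `sℓ₀` of free sup-lattices -/

/-- The full subcategory of the category of sup-lattices on the free ones `ℓX`. -/
structure FreeSupLat where
  carrier : Type u

namespace FreeSupLat

instance : Category FreeSupLat.{u} where
  Hom X Y := sSupHom (Set X.carrier) (Set Y.carrier)
  id X := sSupHom.id _
  comp f g := g.comp f

/-- The linear map `ℓX → ℓY` that corresponds to a relation: the direct image. -/
def directImage {X Y : Type u} (R : SetRel X Y) : sSupHom (Set X) (Set Y) where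
  toFun A := R.image A
  map_sSup' A := by
    rw [sSup_image]
    exact SetRel.image_sUnion _ A

/-- The functor `ℓ : Rel ⥤ sℓ₀`. -/
def ell : RelCat.{u} ⥤ FreeSupLat.{u} where
  obj X := ⟨X⟩
  map R := directImage R.rel
  map_id X := sSupHom.ext fun A => SetRel.image_id A
  map_comp R S := sSupHom.ext fun A => SetRel.image_comp _ _ _

theorem mem_map_iff {X Y : Type*} (f : sSupHom (Set X) (Set Y)) (A : Set X) (y : Y) :
    y ∈ f A ↔ ∃ x, x ∈ A ∧ y ∈ f {x} := by
  have h : A = ⨆ x ∈ A, ({x} : Set X) := by simp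
  conv_lhs => rw [h]
  rw [map_iSup₂]
  simp only [Set.iSup_eq_iUnion, Set.mem_iUnion, exists_prop]

/-- The inverse of `ℓ`: a linear map `f` goes to the relation `y ∈ f {x}`. -/
def ellInv : FreeSupLat.{u} ⥤ RelCat.{u} where
  obj X := X.carrier
  map f := .ofRel {p | p.2 ∈ f.toFun {p.1}}
  map_id X := RelCat.Hom.ext _ _ (Set.ext fun p => eq_comm)
  map_comp {X Y Z} f g := RelCat.Hom.ext _ _ (Set.ext fun p => mem_map_iff g _ p.2)

theorem ell_ellInv : ell.{u} ⋙ ellInv = 𝟭 _ :=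
  CategoryTheory.Functor.hext (fun X => rfl) fun X Y R => heq_of_eq
    (RelCat.Hom.ext _ _ (Set.ext fun p =>
      ⟨fun ⟨a, h, h'⟩ => by cases h; exact h', fun h => ⟨p.1, rfl, h⟩⟩))

theorem ellInv_ell : ellInv.{u} ⋙ ell = 𝟭 _ :=
  CategoryTheory.Functor.hext (fun X => rfl) fun X Y f => heq_of_eq
    (sSupHom.ext fun A => Set.ext fun y => (mem_map_iff f A y).symm)

end FreeSupLat

/-! ### The category `Cmd₀(G)` -/

/-- A comodule structure over `G` on a sup-lattice `S`. -/
structure Comodule (G : Type v) [Order.Frame G] [LocalicGroup G]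
    (S : Type u) [CompleteLattice S] where
  coact : sSupHom S (SupTensor G S)
  coassoc : ∀ x, SupTensor.map (sSupHom.id G) coact (coact x) =
    SupTensor.assoc G G S
      (SupTensor.map LocalicGroup.comul.lin (sSupHom.id S) (coact x))
  counit : ∀ x,
    SupTensor.lid S (SupTensor.map LocalicGroup.counit.lin (sSupHom.id S) (coact x)) = x

/-- Comodule morphisms: the linear maps that commute with the coactions. -/
def IsComoduleHom {G : Type v} [Order.Frame G] [LocalicGroup G] {S T : Type*}
    [CompleteLattice S] [CompleteLattice T] (ρ : Comodule G S) (σ : Comodule G T)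
    (f : sSupHom S T) : Prop :=
  ∀ x, σ.coact (f x) = SupTensor.map (sSupHom.id G) f (ρ.coact x)

/-- A comodule over `G` of the form `ℓX`. -/
structure Cmd₀ (G : Type v) [Order.Frame G] [LocalicGroup G] where
  carrier : Type u
  comodule : Comodule G (Set carrier)

namespace Cmd₀

variable {G : Type v} [Order.Frame G] [LocalicGroup G]

instance : Category (Cmd₀.{u, v} G) where
  Hom S T := {f : sSupHom (Set S.carrier) (Set T.carrier) //
    IsComoduleHom S.comodule T.comodule f}
  id S := ⟨sSupHom.id _, fun x => DFunLike.congr_fun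
    (SupTensor.hom_ext (f := sSupHom.id _) (g := SupTensor.map (sSupHom.id G) (sSupHom.id _))
      fun a b => by simp) (S.comodule.coact x)⟩
  comp {S T U} f g := ⟨g.1.comp f.1, fun x => by
    rw [sSupHom.comp_apply, g.2, f.2]
    exact DFunLike.congr_fun (SupTensor.hom_ext
      (f := (SupTensor.map (sSupHom.id G) g.1).comp (SupTensor.map (sSupHom.id G) f.1))
      (g := SupTensor.map (sSupHom.id G) (g.1.comp f.1)) fun a b => by simp)
      (S.comodule.coact x)⟩

/-- The functor `T : Cmd₀(G) ⥤ sℓ₀` that forgets the comodule structure. -/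
def forgetful (G : Type v) [Order.Frame G] [LocalicGroup G] :
    Cmd₀.{u, v} G ⥤ FreeSupLat.{u} where
  obj S := ⟨S.carrier⟩
  map f := f.1

end Cmd₀

/-! Since `ℓX` is free on the points of `X`, an element of `G ⊗ ℓX` has a unique expansion `⋁ x, g x
⊗ {x}`. A linear map `ρ : ℓX → G ⊗ ℓX` is therefore the same as a matrix `X × X → G`, also written
`ρ`. Coassociativity and the counit law become `w ρ(a,b) = ⋁ z, ρ(a,z) ⊗ ρ(z,b)` and `e ρ(a,b) = (a
= b)`, which are exactly two of the conditions for the matrix to define an action of `G`.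

The remaining conditions come for free. Applied to `ρ(a,b)`, the antipode axioms say that the
matrices `ι ρ` and `ρ` are inverse to each other, with entries multiplied by `⊓`. A join equal to
`⊥` has all its terms equal to `⊥`, so the vanishing of the off-diagonal entries holds term by term.
This forces `ι ρ(a,b) = ρ(b,a)` (`antipode_matrix`), and then the inverse laws are the four axioms
of an `ℓ`-bijection (`isLBijection_matrix`). Comodule structures on `ℓX` and actions on `X` are thus
the same matrices.

For arrows, a linear map `ℓX → ℓY` is the direct image of a relation `R`. It respects the coactions
exactly when `R` is invariant: `ρ(a,x) ⊓ σ(b,y) = ⊥` whenever `(a,b) ∈ R` and `(x,y) ∉ R`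
(`isComoduleHom_directImage_iff`). The matrix of the product action is `ρ(a,x) ⊓ σ(b,y)`, so
invariance is also what allows the product action to restrict to `R`, and the invariant relations
are those underlying subobjects of the product (`exists_relMap_eq_iff`). A subobject is determined
by its underlying relation (`relMap_injective`), so functoriality and the inverse laws on arrows
reduce to identities between relations or direct images. -/

/-! ### Linear maps out of `ℓX` and relations -/

namespace FreeSupLat

/-- The linear map `ℓX → S` that extends a function on points. -/
def extend {X S : Type*} [CompleteLattice S] (f : X → S) : sSupHom (Set X) S where
  toFun A := ⨆ a ∈ A, f a
  map_sSup' 𝒜 := by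
    refine eq_of_forall_ge_iff fun c => ?_
    simp only [sSup_image, Set.sSup_eq_sUnion, iSup_le_iff, Set.mem_sUnion]
    exact ⟨fun h A hA a ha => h a ⟨A, hA, ha⟩, fun h a ⟨A, hA, ha⟩ => h A hA a ha⟩

theorem extend_apply {X S : Type*} [CompleteLattice S] (f : X → S) (A : Set X) :
    extend f A = ⨆ a ∈ A, f a := rfl

@[simp]
theorem extend_singleton {X S : Type*} [CompleteLattice S] (f : X → S) (a : X) :
    extend f {a} = f a := by simp [extend_apply]

/-- Linear maps out of `ℓX` are determined by their values on points. -/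
theorem hom_ext {X S : Type*} [CompleteLattice S] {f g : sSupHom (Set X) S}
    (h : ∀ a, f {a} = g {a}) : f = g := by
  ext A
  have hA : A = ⨆ x ∈ A, ({x} : Set X) := by simp
  rw [hA, map_iSup₂, map_iSup₂]
  simp only [h]

theorem directImage_singleton {X Y : Type u} (R : SetRel X Y) (a : X) :
    directImage R {a} = {y | (a, y) ∈ R} :=
  Set.ext fun y => ⟨fun ⟨_, h, h'⟩ => by cases h; exact h', fun h => ⟨a, rfl, h⟩⟩

theorem directImage_injective {X Y : Type u} :
    Function.Injective (directImage : SetRel X Y → _) := fun R S h => Set.ext fun ⟨a, y⟩ => by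
  have := congrArg (y ∈ · {a}) h
  simpa only [directImage_singleton, Set.mem_ofPred_eq, eq_iff_iff] using this

/-- The relation that corresponds to a linear map `ℓX → ℓY`. -/
def toRel {X Y : Type u} (f : sSupHom (Set X) (Set Y)) : SetRel X Y := {p | p.2 ∈ f {p.1}}

@[simp]
theorem directImage_toRel {X Y : Type u} (f : sSupHom (Set X) (Set Y)) :
    directImage (toRel f) = f := hom_ext fun a => by
  rw [directImage_singleton]; rfl

@[simp]
theorem toRel_directImage {X Y : Type u} (R : SetRel X Y) : toRel (directImage R) = R :=
  directImage_injective (directImage_toRel _)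

end FreeSupLat

/-! ### Coefficients of elements of `S ⊗ ℓX` -/

namespace SupTensor

section Coeff

variable {S : Type*} [CompleteLattice S] {X : Type*}

theorem isBilin_coeff (S : Type*) [CompleteLattice S] (x : X) :
    IsBilin fun (s : S) (A : Set X) => ⨆ _ : x ∈ A, s where
  sSup_left A B := isBilin_rid.sSup_left A (x ∈ B)
  sSup_right s 𝒜 := by
    simp only [Set.sSup_eq_sUnion, Set.mem_sUnion, iSup_exists, iSup_and]

/-- The coefficient at `x` of an element of `S ⊗ ℓX`. -/
def coeff (S : Type*) [CompleteLattice S] (x : X) : sSupHom (SupTensor S (Set X)) S :=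
  lift _ (isBilin_coeff S x)

@[simp]
theorem coeff_tmul (x : X) (s : S) (A : Set X) : coeff S x (tmul s A) = ⨆ _ : x ∈ A, s :=
  lift_tmul _ _ _ _

theorem tmul_eq_iSup_singleton (s : S) (A : Set X) : tmul s A = ⨆ x ∈ A, tmul s {x} := by
  have hA : A = sSup ((fun x => ({x} : Set X)) '' A) := by simp [sSup_image]
  conv_lhs => rw [hA, isBilin_tmul.sSup_right, iSup_image]

/-- As `ℓX` is a coproduct of `X` copies of `2`, tensoring with `S` gives the power `S^X`. This
expansion is what turns coactions into matrices. -/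
theorem eq_iSup_coeff (D : SupTensor S (Set X)) : D = ⨆ x, tmul (coeff S x D) {x} := by
  apply le_antisymm
  · rw [le_iff_tmul]
    intro s A h
    rw [tmul_eq_iSup_singleton]
    refine iSup₂_le fun x hx => le_iSup_of_le x (tmul_mono ?_ le_rfl)
    refine le_trans ?_ (OrderHomClass.mono (coeff S x) h)
    simp [hx]
  · refine iSup_le fun x => ?_
    -- The coefficient is a join over the pairs in `D`; closure of `D` under joins in the first
    -- variable allows each pair to be treated separately.
    rw [tmul_le_iff, coeff, lift_apply, ← sSup_image, D.left_mem]
    rintro _ ⟨p, hp, rfl⟩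
    by_cases hx : x ∈ p.2
    · simp only [hx, iSup_pos]
      exact D.mem_of_le_right (by simpa using hx) hp
    -- Such a pair contributes `⊥`, and `(⊥, {x})` lies in every element of the tensor product by
    -- closure under the empty join.
    · simp only [hx, iSup_false, ← sSup_empty]
      exact (D.left_mem ∅ {x}).2 (by simp)

theorem ext_coeff {D E : SupTensor S (Set X)} (h : ∀ x, coeff S x D = coeff S x E) : D = E := by
  rw [eq_iSup_coeff D, eq_iSup_coeff E]
  simp only [h]

-- Uniqueness of the expansion in `eq_iSup_coeff`: any family of coefficients is recovered from the
-- element it defines.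
@[simp]
theorem coeff_iSup_tmul_singleton (f : X → S) (x : X) :
    coeff S x (⨆ y, tmul (f y) {y}) = f x := by
  rw [map_iSup]
  simp only [coeff_tmul, Set.mem_singleton_iff]
  exact iSup_iSup_eq_right

end Coeff

end SupTensor

open SupTensor

/-! ### The matrix of a comodule is an action -/

namespace Comodule

variable {G : Type v} [Order.Frame G] [LocalicGroup G] {X Y : Type u}

/-- The matrix of a coaction on `ℓX`. -/
def matrix (ρ : Comodule G (Set X)) (a b : X) : G := coeff G b (ρ.coact {a})

variable (ρ : Comodule G (Set X))

theorem coact_singleton (a : X) : ρ.coact {a} = ⨆ x, tmul (ρ.matrix a x) {x} :=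
  eq_iSup_coeff _

theorem ext_matrix {ρ σ : Comodule G (Set X)} (h : ∀ a b, ρ.matrix a b = σ.matrix a b) :
    ρ = σ := by
  have : ρ.coact = σ.coact := FreeSupLat.hom_ext fun a => ext_coeff fun x => h a x
  cases ρ; cases σ; cases this; rfl

/-- Coassociativity at the point `{a}`, read off at the coefficient `b` of the last factor. -/
theorem comul_matrix (a b : X) : LocalicGroup.comul (ρ.matrix a b) =
    ⨆ z, tmul (ρ.matrix a z) (ρ.matrix z b) := by
  have h := congrArg (SupTensor.map (sSupHom.id G) (coeff G b)) (ρ.coassoc {a})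
  simp only [coact_singleton, map_iSup, map_tmul, sSupHom.id_apply, coeff_tmul,
    Set.mem_singleton_iff, iSup_iSup_eq_right, FrameHom.lin_apply] at h
  rw [h]
  -- The comultiplication of an entry is not a pure tensor, whereas `assoc` is computed on pure
  -- tensors; hence the decomposition of a general `D`. Only the term `x = b` survives.
  have key : ∀ D : SupTensor G G, ∀ x : X, SupTensor.map (sSupHom.id G) (coeff G b)
      (assoc G G (Set X) (tmul D {x})) = ⨆ _ : b = x, D := by
    intro D x
    rw [eq_iSup_tmul D]
    simp only [iSup_tmul, map_iSup, assoc_tmul, map_tmul, coeff_tmul, Set.mem_singleton_iff,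
      sSupHom.id_apply, tmul_iSup]
    by_cases hx : b = x <;> simp [hx]
  simp only [key, iSup_iSup_eq_right]

theorem counit_matrix (a b : X) : LocalicGroup.counit (ρ.matrix a b) = (a = b) := by
  have h := ρ.counit {a}
  simp only [coact_singleton, map_iSup, map_tmul, sSupHom.id_apply, lid_tmul,
    FrameHom.lin_apply] at h
  have h' := congrArg (b ∈ ·) h
  simpa [eq_comm] using h'

/-- The antipode axiom at an entry of the matrix: `ι ρ` is a left inverse of `ρ`, for the matrix
product formed with `⊓` and `⋁`. The next lemma gives the right inverse. -/
theorem iSup_antipode_inf (a b : X) :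
    ⨆ z, LocalicGroup.antipode (ρ.matrix a z) ⊓ ρ.matrix z b = ⨆ _ : a = b, ⊤ := by
  have h := LocalicGroup.antipode_left (ρ.matrix a b)
  simpa only [comul_matrix, counit_matrix, map_iSup, map_tmul, mul_tmul, sSupHom.id_apply,
    FrameHom.lin_apply] using h

theorem iSup_inf_antipode (a b : X) :
    ⨆ z, ρ.matrix a z ⊓ LocalicGroup.antipode (ρ.matrix z b) = ⨆ _ : a = b, ⊤ := by
  have h := LocalicGroup.antipode_right (ρ.matrix a b)
  simpa only [comul_matrix, counit_matrix, map_iSup, map_tmul, mul_tmul, sSupHom.id_apply,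
    FrameHom.lin_apply] using h

/-- No cancellation occurs in a join, so a vanishing off-diagonal entry of the product vanishes term
by term. -/
theorem antipode_inf_eq_bot {a b : X} (h : a ≠ b) (z : X) :
    LocalicGroup.antipode (ρ.matrix a z) ⊓ ρ.matrix z b = ⊥ := by
  have h' := ρ.iSup_antipode_inf a b
  simp only [h, iSup_false, iSup_eq_bot] at h'
  exact h' z

theorem inf_antipode_eq_bot {a b : X} (h : a ≠ b) (z : X) :
    ρ.matrix a z ⊓ LocalicGroup.antipode (ρ.matrix z b) = ⊥ := by
  have h' := ρ.iSup_inf_antipode a b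
  simp only [h, iSup_false, iSup_eq_bot] at h'
  exact h' z

/-- Each inequality meets one side with a diagonal entry of an inverse law, which is a join equal to
`⊤`. Associating the meet the other way, off-diagonal vanishing kills all terms but one, and that
one lies below the other side. -/
theorem antipode_matrix (a b : X) : LocalicGroup.antipode (ρ.matrix a b) = ρ.matrix b a := by
  apply le_antisymm
  · have h := ρ.iSup_inf_antipode b b
    simp only [iSup_pos] at h
    rw [← inf_top_eq (LocalicGroup.antipode _), ← h, inf_iSup_eq]
    refine iSup_le fun x => ?_
    by_cases hx : a = x
    · subst hx; exact inf_le_right.trans inf_le_left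
    · rw [← inf_assoc, ρ.antipode_inf_eq_bot hx, bot_inf_eq]; exact bot_le
  · have h := ρ.iSup_antipode_inf a a
    simp only [iSup_pos] at h
    rw [← inf_top_eq (ρ.matrix b a), ← h, inf_iSup_eq]
    refine iSup_le fun x => ?_
    by_cases hx : b = x
    · subst hx; exact inf_le_right.trans inf_le_left
    · rw [← inf_assoc, ρ.inf_antipode_eq_bot hx, bot_inf_eq]; exact bot_le

/-- The diagonal entries of the two inverse laws give totality and surjectivity. The off-diagonal
ones give univalence and injectivity, once `ι` is replaced by transposition. -/
theorem isLBijection_matrix : IsLBijection ρ.matrix where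
  ed a := top_le_iff.1 (by
    have h := ρ.iSup_inf_antipode a a
    simp only [iSup_pos] at h
    rw [← h]
    exact iSup_mono fun _ => inf_le_left)
  su a := top_le_iff.1 (by
    have h := ρ.iSup_antipode_inf a a
    simp only [iSup_pos] at h
    rw [← h]
    exact iSup_mono fun _ => inf_le_right)
  uv x b₁ b₂ hb := by rw [← antipode_matrix, ρ.antipode_inf_eq_bot hb]
  inj a₁ a₂ y ha := by rw [← ρ.antipode_matrix y a₂, ρ.inf_antipode_eq_bot ha]

/-- The `G`-set of a comodule structure on `ℓX`. -/
def toGSet : GSet.{u, v} G :=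
  GSet.ofRel X ρ.matrix ρ.isLBijection_matrix ρ.comul_matrix ρ.counit_matrix ρ.antipode_matrix

@[simp]
theorem rel_toGSet (a b : X) : ρ.toGSet.rel a b = ρ.matrix a b := GSet.rel_ofRel _ _ _ _ _ _ _ _

/-! ### Comodule morphisms as invariant relations -/

/-- The square is tested on points `{a}` and on coefficients `y`. With `R` the relation of `f`, it
becomes the equality of matrix products `R σ = ρ R`. -/
theorem isComoduleHom_iff {σ : Comodule G (Set Y)} {f : sSupHom (Set X) (Set Y)} :
    IsComoduleHom ρ σ f ↔
      ∀ a y, ⨆ b ∈ f {a}, σ.matrix b y = ⨆ x, ⨆ _ : y ∈ f {x}, ρ.matrix a x := by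
  have h₁ : IsComoduleHom ρ σ f ↔ σ.coact.comp f =
      (SupTensor.map (sSupHom.id G) f).comp ρ.coact :=
    ⟨fun h => sSupHom.ext h, fun h => DFunLike.congr_fun h⟩
  have hf : ∀ a, f {a} = ⨆ b ∈ f {a}, {b} := fun a => by simp
  have hl : ∀ a y, coeff G y (σ.coact (f {a})) = ⨆ b ∈ f {a}, σ.matrix b y := fun a y => by
    conv_lhs => rw [hf a]
    rw [map_iSup₂, map_iSup₂]; rfl
  have hr : ∀ a y, coeff G y (SupTensor.map (sSupHom.id G) f (ρ.coact {a})) =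
      ⨆ x, ⨆ _ : y ∈ f {x}, ρ.matrix a x := fun a y => by
    simp only [coact_singleton, map_iSup, map_tmul, sSupHom.id_apply, coeff_tmul]
  rw [h₁]
  constructor
  · intro h a y
    rw [← hl, ← hr]
    exact congrArg (coeff G y) (DFunLike.congr_fun h {a})
  · intro h
    refine FreeSupLat.hom_ext fun a => ext_coeff fun y => ?_
    exact (hl a y).trans ((h a y).trans (hr a y).symm)

/-- The comodule morphisms correspond to the invariant relations. -/
theorem isComoduleHom_directImage_iff {σ : Comodule G (Set Y)} {R : SetRel X Y} :
    IsComoduleHom ρ σ (FreeSupLat.directImage R) ↔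
      ∀ p ∈ R, ∀ q ∉ R, ρ.matrix p.1 q.1 ⊓ σ.matrix p.2 q.2 = ⊥ := by
  rw [isComoduleHom_iff]
  simp only [FreeSupLat.directImage_singleton, Set.mem_ofPred_eq]
  constructor
  · rintro h ⟨a, b⟩ hp ⟨x, y⟩ hq
    rw [← le_bot_iff]
    -- The matrix identity bounds `σ(b,y)` by the join of the `ρ(a,x')` with `(x',y) ∈ R`. None of
    -- these `x'` is `x`, so univalence of `ρ` makes each meet with `ρ(a,x)` vanish.
    refine (inf_le_inf_left _ ((le_iSup₂ (f := fun b (_ : (a, b) ∈ R) => σ.matrix b y) b hp).trans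
      (h a y).le)).trans ?_
    simp only [inf_iSup_eq]
    refine iSup₂_le fun x' hx' => (ρ.isLBijection_matrix.uv a x x' ?_).le
    rintro rfl
    exact hq hx'
  · intro h a y
    apply le_antisymm
    · refine iSup₂_le fun b hb => ?_
      -- The row `ρ(a,-)` covers `⊤`; invariance removes the part where `(x,y) ∉ R`.
      rw [← top_inf_eq (σ.matrix b y), ← ρ.isLBijection_matrix.ed a, iSup_inf_eq]
      refine iSup_le fun x => ?_
      by_cases hx : (x, y) ∈ R
      · exact inf_le_left.trans (le_iSup₂ (f := fun x (_ : (x, y) ∈ R) => ρ.matrix a x) x hx)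
      · rw [h (a, b) hb (x, y) hx]; exact bot_le
    · refine iSup₂_le fun x hx => ?_
      rw [← inf_top_eq (ρ.matrix a x), ← σ.isLBijection_matrix.su y, inf_iSup_eq]
      refine iSup_le fun b => ?_
      by_cases hb : (a, b) ∈ R
      · exact inf_le_right.trans (le_iSup₂ (f := fun b (_ : (a, b) ∈ R) => σ.matrix b y) b hb)
      -- Invariance concerns passing from `R` to its complement, while here the passage is from
      -- `(a,b) ∉ R` to `(x,y) ∈ R`; the antipode transposes both entries and so reverses it.
      · rw [← ρ.antipode_matrix, ← σ.antipode_matrix, ← map_inf, h (x, y) hx (a, b) hb, map_bot]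
        exact bot_le

end Comodule

/-! ### The comodule of an action, and subobjects as invariant relations -/

namespace GSet

variable {G : Type v} [Order.Frame G] [LocalicGroup G]

/-- The linear map `ℓX → G ⊗ ℓX` of a `G`-set `X`. -/
def coact (X : GSet.{u, v} G) : sSupHom (Set X.carrier) (SupTensor G (Set X.carrier)) :=
  FreeSupLat.extend fun a => ⨆ x, tmul (X.rel a x) {x}

theorem coact_singleton (X : GSet.{u, v} G) (a : X.carrier) :
    X.coact {a} = ⨆ x, tmul (X.rel a x) {x} := FreeSupLat.extend_singleton _ _

/-- Phrased as an equality of linear maps so that points suffice. There, by `comul_rel`, both sides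
are the double join of `μ⟨a | z⟩ ⊗ (μ⟨z | x⟩ ⊗ {x})`, taken in the two orders. -/
theorem coact_coassoc (X : GSet.{u, v} G) :
    (SupTensor.map (sSupHom.id G) X.coact).comp X.coact =
      ((assoc G G (Set X.carrier)).comp
        (SupTensor.map LocalicGroup.comul.lin (sSupHom.id (Set X.carrier)))).comp X.coact :=
  FreeSupLat.hom_ext fun a => by
    simp only [sSupHom.comp_apply, coact_singleton, map_iSup, map_tmul, sSupHom.id_apply,
      FrameHom.lin_apply, comul_rel, iSup_tmul, tmul_iSup, assoc_tmul]
    exact iSup_comm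

theorem coact_counit (X : GSet.{u, v} G) :
    ((lid (Set X.carrier)).comp
      (SupTensor.map LocalicGroup.counit.lin (sSupHom.id (Set X.carrier)))).comp X.coact =
        sSupHom.id (Set X.carrier) :=
  FreeSupLat.hom_ext fun a => by
    simp only [sSupHom.comp_apply, coact_singleton, map_iSup, map_tmul, sSupHom.id_apply,
      FrameHom.lin_apply, counit_rel, lid_tmul]
    exact iSup_iSup_eq_right

/-- The comodule structure on `ℓX` of a `G`-set `X`. -/
def toComodule (X : GSet.{u, v} G) : Comodule G (Set X.carrier) where
  coact := X.coact
  coassoc x := DFunLike.congr_fun X.coact_coassoc x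
  counit x := DFunLike.congr_fun X.coact_counit x

@[simp]
theorem matrix_toComodule (X : GSet.{u, v} G) (a b : X.carrier) :
    X.toComodule.matrix a b = X.rel a b := by
  rw [Comodule.matrix, toComodule, coact_singleton, coeff_iSup_tmul_singleton]

theorem act_ext {X : Type u} {μ ν : HopfHom (AutLocale X) G}
    (h : ∀ a b, μ.hom (AutLocale.gen a b) = ν.hom (AutLocale.gen a b)) : μ = ν := by
  have : μ.hom = ν.hom := AutLocale.hom_ext h
  cases μ; cases ν; cases this; rfl

/-- The underlying relations of the subobjects of a product are the invariant relations. -/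
theorem exists_relMap_eq_iff {X Y : GSet.{u, v} G} {R : SetRel X.carrier Y.carrier} :
    (∃ S : Subobject (X ⨯ Y), relMap (forgetful G) S = R) ↔
      ∀ p ∈ R, ∀ q ∉ R, X.rel p.1 q.1 ⊓ Y.rel p.2 q.2 = ⊥ := by
  constructor
  · rintro ⟨S, rfl⟩ p hp q hq
    -- The relation underlying `S` is the range of a morphism into the explicit product, and ranges
    -- are invariant.
    have h := rel_range (prodPair (S.arrow ≫ prod.fst) (S.arrow ≫ prod.snd)) p hp q hq
    rwa [rel_prodObj] at h
  · intro h
    have h' : ∀ p ∈ R, ∀ q ∉ R, (prodObj X Y).rel p q = ⊥ := fun p hp q hq => by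
      rw [rel_prodObj, h p hp q hq]
    -- The sub-`G`-set `R` lives in the explicit product `prodObj X Y`, while subobjects are taken
    -- in the chosen product `X ⨯ Y`. Taking the image of the comparison map makes it unnecessary to
    -- show that this map is mono.
    refine ⟨imageSubobject (prod.lift (subIncl (prodObj X Y) R h' ≫ prodFst X Y)
      (subIncl (prodObj X Y) R h' ≫ prodSnd X Y)), Set.ext fun ⟨x, y⟩ => ?_⟩
    refine mem_relMap_image.trans ?_
    simp only [prod.lift_fst, prod.lift_snd]
    exact ⟨fun ⟨w, h₁, h₂⟩ => by cases h₁; cases h₂; exact w.2, fun h => ⟨⟨(x, y), h⟩, rfl, rfl⟩⟩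

/-- Both sides are invariance of `R`. Assuming only that the matrices agree makes the lemma usable
both for the `G`-set of a comodule and for the comodule of a `G`-set. -/
theorem exists_relMap_iff_isComoduleHom {X Y : GSet.{u, v} G} {ρ : Comodule G (Set X.carrier)}
    {σ : Comodule G (Set Y.carrier)} (hX : ∀ a b, ρ.matrix a b = X.rel a b)
    (hY : ∀ a b, σ.matrix a b = Y.rel a b) {R : SetRel X.carrier Y.carrier} :
    (∃ S : Subobject (X ⨯ Y), relMap (forgetful G) S = R) ↔
      IsComoduleHom ρ σ (FreeSupLat.directImage R) := by
  rw [exists_relMap_eq_iff, Comodule.isComoduleHom_directImage_iff]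
  simp only [hX, hY]

end GSet

/-! ### The two functors -/

namespace Cmd₀

variable {G : Type v} [Order.Frame G] [LocalicGroup G]

theorem exists_relMap_eq_toRel {S T : Cmd₀.{u, v} G} (f : S ⟶ T) :
    ∃ R : Subobject (S.comodule.toGSet ⨯ T.comodule.toGSet),
      relMap (GSet.forgetful G) R = FreeSupLat.toRel f.1 :=
  (GSet.exists_relMap_iff_isComoduleHom (X := S.comodule.toGSet) (Y := T.comodule.toGSet)
    (fun a b => (S.comodule.rel_toGSet a b).symm)
    (fun a b => (T.comodule.rel_toGSet a b).symm)).2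
      ((congrArg (IsComoduleHom S.comodule T.comodule) (FreeSupLat.directImage_toRel f.1)).mpr f.2)

/-- The subobject that corresponds to a comodule morphism. -/
noncomputable def toSubobject {S T : Cmd₀.{u, v} G} (f : S ⟶ T) :
    Subobject (S.comodule.toGSet ⨯ T.comodule.toGSet) := (exists_relMap_eq_toRel f).choose

theorem relMap_toSubobject {S T : Cmd₀.{u, v} G} (f : S ⟶ T) :
    relMap (GSet.forgetful G) (toSubobject f) = FreeSupLat.toRel f.1 :=
  (exists_relMap_eq_toRel f).choose_spec

/-- The functor `Cmd₀(G) ⥤ Rel(β^G)`. -/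
noncomputable def toRelGSet (G : Type v) [Order.Frame G] [LocalicGroup G] :
    Cmd₀.{u, v} G ⥤ RelGSet.{u, v} G where
  obj S := ⟨S.comodule.toGSet⟩
  map f := toSubobject f
  map_id S := GSet.relMap_injective ((relMap_toSubobject (𝟙 S)).trans
    ((Set.ext fun p => eq_comm).trans (GSet.relMap_relId S.comodule.toGSet).symm))
  map_comp {S T U} f g := GSet.relMap_injective ((relMap_toSubobject (f ≫ g)).trans (by
    refine Eq.trans ?_ (GSet.relMap_relComp (toSubobject f) (toSubobject g)).symm
    rw [relMap_toSubobject, relMap_toSubobject]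
    -- A linear map is determined by points, so `y ∈ g (f {x})` amounts to an intermediate `z ∈ f
    -- {x}` with `y ∈ g {z}`, which is relational composition.
    exact Set.ext fun p => FreeSupLat.mem_map_iff g.1 _ p.2))

/-- A round trip returns a comodule structure that is equal to the original one by a theorem, not by
definition, so arrows have to be compared heterogeneously. The carriers do agree by definition, and
the underlying linear maps can be compared directly. -/
theorem hom_heq {X Y : Type u} {ρ ρ' : Comodule G (Set X)} {σ σ' : Comodule G (Set Y)}
    (hρ : ρ = ρ') (hσ : σ = σ') {f : (⟨X, ρ⟩ : Cmd₀.{u, v} G) ⟶ ⟨Y, σ⟩}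
    {f' : (⟨X, ρ'⟩ : Cmd₀.{u, v} G) ⟶ ⟨Y, σ'⟩} (h : f.1 = f'.1) : HEq f f' := by
  subst hρ hσ
  exact heq_of_eq (Subtype.ext h)

end Cmd₀

namespace RelGSet

variable {G : Type v} [Order.Frame G] [LocalicGroup G]

/-- The underlying relation of an arrow of `Rel(β^G)`. -/
def Hom.rel {X Y : RelGSet.{u, v} G} (R : X ⟶ Y) : SetRel X.obj.carrier Y.obj.carrier :=
  relMap (GSet.forgetful G) (X := X.obj) (Y := Y.obj) R

/-- The functor `Rel(β^G) ⥤ Cmd₀(G)`. -/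
noncomputable def toCmd₀ (G : Type v) [Order.Frame G] [LocalicGroup G] :
    RelGSet.{u, v} G ⥤ Cmd₀.{u, v} G where
  obj X := ⟨X.obj.carrier, X.obj.toComodule⟩
  map {X Y} R := ⟨FreeSupLat.directImage (Hom.rel R),
    (GSet.exists_relMap_iff_isComoduleHom X.obj.matrix_toComodule Y.obj.matrix_toComodule).1
      ⟨R, rfl⟩⟩
  map_id X := Subtype.ext ((congrArg FreeSupLat.directImage (GSet.relMap_relId X.obj)).trans
    (sSupHom.ext fun A => SetRel.image_id A))
  map_comp {X Y Z} R S := Subtype.ext ((congrArg FreeSupLat.directImage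
    (GSet.relMap_relComp (X := X.obj) (Y := Y.obj) (Z := Z.obj) R S)).trans
      (sSupHom.ext fun A => SetRel.image_comp _ _ _))

theorem hom_heq {X Y : Type u} {μ μ' : HopfHom (AutLocale X) G} {ν ν' : HopfHom (AutLocale Y) G}
    (hμ : μ = μ') (hν : ν = ν') {R : (⟨⟨X, μ⟩⟩ : RelGSet.{u, v} G) ⟶ ⟨⟨Y, ν⟩⟩}
    {R' : (⟨⟨X, μ'⟩⟩ : RelGSet.{u, v} G) ⟶ ⟨⟨Y, ν'⟩⟩} (h : Hom.rel R = Hom.rel R') :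
    HEq R R' := by
  subst hμ hν
  exact heq_of_eq (GSet.relMap_injective h)

end RelGSet

/-! ### The functors are inverse, and the main theorem -/

section Inverse

variable (G : Type v) [Order.Frame G] [LocalicGroup G]

theorem toComodule_toGSet {X : Type u} (ρ : Comodule G (Set X)) : ρ.toGSet.toComodule = ρ :=
  Comodule.ext_matrix fun a b =>
    (ρ.toGSet.matrix_toComodule a b).trans (ρ.rel_toGSet a b)

/-- The round trip leaves the carrier unchanged by definition, so the two actions have the same type
and only their matrices need comparing. -/
theorem act_toGSet_toComodule (X : GSet.{u, v} G) : X.toComodule.toGSet.act = X.act :=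
  GSet.act_ext fun a b =>
    (X.toComodule.rel_toGSet a b).trans (X.matrix_toComodule a b)

theorem toRelGSet_comp_toCmd₀ : Cmd₀.toRelGSet.{u, v} G ⋙ RelGSet.toCmd₀ G = 𝟭 _ :=
  CategoryTheory.Functor.hext
    (fun S => congrArg (Cmd₀.mk S.carrier) (toComodule_toGSet G S.comodule)) fun S T f =>
      Cmd₀.hom_heq (toComodule_toGSet G S.comodule) (toComodule_toGSet G T.comodule)
        ((congrArg FreeSupLat.directImage (Cmd₀.relMap_toSubobject f)).trans
          (FreeSupLat.directImage_toRel f.1))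

theorem toCmd₀_comp_toRelGSet : RelGSet.toCmd₀.{u, v} G ⋙ Cmd₀.toRelGSet G = 𝟭 _ :=
  CategoryTheory.Functor.hext
    (fun X => congrArg (fun μ => RelGSet.mk ⟨X.obj.carrier, μ⟩) (act_toGSet_toComodule G X.obj))
    fun X Y R => RelGSet.hom_heq (act_toGSet_toComodule G X.obj) (act_toGSet_toComodule G Y.obj)
      ((Cmd₀.relMap_toSubobject ((RelGSet.toCmd₀ G).map R)).trans
        (FreeSupLat.toRel_directImage (RelGSet.Hom.rel R)))

theorem toRelGSet_comp_relForget :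
    Cmd₀.toRelGSet.{u, v} G ⋙ RelGSet.relForget G ⋙ FreeSupLat.ell = Cmd₀.forgetful G :=
  CategoryTheory.Functor.hext (fun S => rfl) fun S T f => heq_of_eq
    ((congrArg FreeSupLat.directImage (Cmd₀.relMap_toSubobject f)).trans
      (FreeSupLat.directImage_toRel f.1))

end Inverse

/-- The equality `h` of functors is bound by an existential because the last clause needs its action
on objects: the `eqToHom` transports identify the source and target of the underlying map of `f`
with those of the direct image of `R`. -/
theorem mainTheorem9 (G : Type v) [Order.Frame G] [LocalicGroup G] :
    ∃ (Φ : Cmd₀.{u, v} G ⥤ RelGSet.{u, v} G) (Ψ : RelGSet.{u, v} G ⥤ Cmd₀.{u, v} G),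
      Φ ⋙ Ψ = 𝟭 _ ∧ Ψ ⋙ Φ = 𝟭 _ ∧
      ∃ h : Φ ⋙ RelGSet.relForget G ⋙ FreeSupLat.ell = Cmd₀.forgetful G,
        ∀ (S S' : Cmd₀.{u, v} G) (R : SetRel S.carrier S'.carrier),
          IsComoduleHom S.comodule S'.comodule (FreeSupLat.directImage R) ↔
            ∃ f : Φ.obj S ⟶ Φ.obj S',
              FreeSupLat.ell.map ((RelGSet.relForget G).map f) =
                eqToHom (Functor.congr_obj h S) ≫
                  (FreeSupLat.directImage R :
                    (Cmd₀.forgetful G).obj S ⟶ (Cmd₀.forgetful G).obj S') ≫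
                  eqToHom (Functor.congr_obj h S').symm := by
  refine ⟨Cmd₀.toRelGSet G, RelGSet.toCmd₀ G, toRelGSet_comp_toCmd₀ G, toCmd₀_comp_toRelGSet G,
    toRelGSet_comp_relForget G, fun S S' R => ?_⟩
  refine (GSet.exists_relMap_iff_isComoduleHom (X := S.comodule.toGSet) (Y := S'.comodule.toGSet)
    (fun a b => (S.comodule.rel_toGSet a b).symm)
    (fun a b => (S'.comodule.rel_toGSet a b).symm)).symm.trans ?_
  -- Direct image is injective on relations, so the equation of linear maps says that `f` has
  -- underlying relation `R`. For this choice of `Φ` the object equalities hold by definition and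
  -- the transports are identities, whence the final `rfl`.
  refine exists_congr fun f => (FreeSupLat.directImage_injective (X := S.carrier)
    (Y := S'.carrier)).eq_iff.symm.trans (Iff.of_eq (congrArg (_ = ·) ?_))
  rfl
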